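/- Let $n\ge 1$, let $\ell_k,\delta_k\in\mathbb C$ ($k=1,\dots,n$, indices modulo $n$) with $2\ell_k\notin\{0,-1,-2,\dots\}$ for all $k$, and for $u\in\mathbb C$ put $u_k^{\pm}=u+\delta_k\pm\ell_k$. On polynomials in $z_k$ let $$\mathrm L_k(v^+,v^-)=\begin{pmatrix} v^++z_k\partial_k & -\partial_k\\ z_k^2\partial_k+(v^+-v^-)z_k & v^--z_k\partial_k\end{pmatrix},$$ and let $\mathbf t(u)=\operatorname{tr}\,\mathrm L_1(u_1^+,u_1^-)\cdots \mathrm L_n(u_n^+,u_n^-)$, acting on $\mathbb C[z_1,\dots,z_n]$ (trace over $\mathbb C^2$). On $\mathbb C[z_0,z_1,\dots,z_n]$ let $\mathbb P_{k0}$ exchange $z_k$ and $z_0$, let $z_{ij}=z_i-z_j$, and let $$\mathcal R^-_{k0}(u)=\frac{\Gamma(2\ell_k)}{\Gamma(u+\ell_k)}\frac{\Gamma(z_{k0}\partial_k+u+\ell_k)}{\Gamma(z_{k0}\partial_k+2\ell_k)},\qquad \mathcal R^+_{k0}(u)=\frac{\Gamma(1+\ell_k-u)}{\Gamma(2\ell_k)}\frac{\Gamma(z_{0k}\partial_0+2\ell_k)}{\Gamma(z_{0k}\partial_0+1+\ell_k-u)},$$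 where the operators $z_{k0}\partial_k$, $z_{0k}\partial_0$ are diagonalizable with eigenvalues $m=0,1,2,\dots$, and $\frac{\Gamma(b)\Gamma(m+a)}{\Gamma(a)\Gamma(m+b)}$ is read as the quotient of rising factorials $(a)_m/(b)_m$. For an operator $A$ on $\mathbb C[z_0,\dots,z_n]$ the trace over $V_0=\mathbb C[z_0]$ is the operator on $\mathbb C[z_1,\dots,z_n]$ given by $$(\operatorname{tr}_{V_0}A)\Psi=\sum_{m=0}^\infty \tfrac1{m!}\,\partial_0^m A\, z_0^m\Psi\Big|_{z_0=0},$$ whenever for every polynomial $\Psi$ this series converges absolutely, coefficient by coefficient, to a polynomial. Put $$\mathbf Q_\pm(\lambda)=\operatorname{tr}_{V_0}\mathbb P_{10}\mathcal R^{\pm}_{10}(\lambda+\delta_1)\cdots\mathbb P_{n0}\mathcal R^{\pm}_{n0}(\lambda+\delta_n).$$ (1) For every $\lambda\in\mathbb C$ the trace defining $\mathbf Q_-(\lambda)$ exists, and for all $u\in\mathbb C$ $$\mathbf Q_-(\lambda)\cdot\operatorname{tr}\mathrm L_1(u_1^+,u_1^-)\mathrm L_2(u_2^+,u_2^-)\cdots\mathrm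 L_n(u_n^+,u_n^-)=\operatorname{tr}\mathrm L_1(u_2^+,u_1^-)\mathrm L_2(u_3^+,u_2^-)\cdots\mathrm L_n(u_1^+,u_n^-)\cdot\mathbf Q_-(\lambda).$$ (2) Let $\lambda\in\mathbb C$ with $1+\ell_k-\lambda-\delta_k\notin\{0,-1,-2,\dots\}$ for all $k$. The trace defining $\mathbf Q_+(\lambda)$ exists if $\operatorname{Re}\sum_k 2\ell_k>1$. Whenever it exists, for all $u\in\mathbb C$ $$\operatorname{tr}\mathrm L_1(u_1^+,u_1^-)\mathrm L_2(u_2^+,u_2^-)\cdots\mathrm L_n(u_n^+,u_n^-)\cdot\mathbf Q_+(\lambda)=\mathbf Q_+(\lambda)\cdot\operatorname{tr}\mathrm L_1(u_1^+,u_n^-)\mathrm L_2(u_2^+,u_1^-)\cdots\mathrm L_n(u_n^+,u_{n-1}^-).$$ (3) Consequently, for such $\lambda$ for which $\mathbf Q_+(\lambda)$ exists, and for all $\mu,u\in\mathbb C$, the operator $\mathbf Q_+(\lambda)\cdot\mathbb P\cdot\mathbf Q_-(\mu)$, with $\mathbb P\psi(z_1,\dots,z_n)=\psi(z_2,\dots,z_n,z_1)$,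 commutes with $\mathbf t(u)$. -/

import Mathlib

open scoped BigOperators

noncomputable section

namespace SpinChain

open MvPolynomial

/-! Operators on the polynomial spaces `ℂ[z_i : i ∈ σ]`; the product of operators is composition. -/

/-- The operator of multiplication by `z_i`. -/
def mulZ {σ : Type} (i : σ) : Module.End ℂ (MvPolynomial σ ℂ) :=
  LinearMap.mulLeft ℂ (X i)

/-- The operator `∂_i = ∂/∂z_i`. -/
def diffZ {σ : Type} (i : σ) : Module.End ℂ (MvPolynomial σ ℂ) :=
  (pderiv i : Derivation ℂ (MvPolynomial σ ℂ) (MvPolynomial σ ℂ)).toLinearMap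

/-- The Lax operator `L_i(u⁺, u⁻)`: a `2 × 2` matrix whose entries are operators. -/
def lax {σ : Type} (i : σ) (up um : ℂ) :
    Matrix (Fin 2) (Fin 2) (Module.End ℂ (MvPolynomial σ ℂ)) :=
  !![up • 1 + mulZ i * diffZ i, -diffZ i;
     mulZ i ^ 2 * diffZ i + (up - um) • mulZ i, um • 1 - mulZ i * diffZ i]

/-- `tr L_1(u_1⁺, u_1⁻) L_2(u_2⁺, u_2⁻) ⋯ L_n(u_n⁺, u_n⁻)`, an ordered product of `2 × 2` matrices
with operator entries, traced over `ℂ²`. -/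
def transferMatrix {n : ℕ} (up um : Fin n → ℂ) : Module.End ℂ (MvPolynomial (Fin n) ℂ) :=
  ((List.ofFn fun k => lax k (up k) (um k)).prod).trace

/-- The permutation operator `P_{ij}`, which exchanges the variables `z_i` and `z_j`. -/
def permOp {σ : Type} [DecidableEq σ] (i j : σ) : Module.End ℂ (MvPolynomial σ ℂ) :=
  (rename (Equiv.swap i j) : MvPolynomial σ ℂ →ₐ[ℂ] MvPolynomial σ ℂ).toLinearMap

/-- The cyclic shift `(P ψ)(z_1, …, z_n) = ψ(z_2, …, z_n, z_1)`. -/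
def cyclicShift (n : ℕ) [NeZero n] : Module.End ℂ (MvPolynomial (Fin n) ℂ) :=
  (rename (fun k : Fin n => k + 1) :
    MvPolynomial (Fin n) ℂ →ₐ[ℂ] MvPolynomial (Fin n) ℂ).toLinearMap

/-- The substitution `z_i ↦ z_i + c z_j` (all other variables fixed). -/
def translate {σ : Type} [DecidableEq σ] (i j : σ) (c : ℂ) :
    MvPolynomial σ ℂ →ₐ[ℂ] MvPolynomial σ ℂ :=
  aeval (Function.update X i (X i + C c * X j))

/-- The operator `f(z_i ∂_i)`: multiplication of each monomial by `f` of its degree in `z_i`. -/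
def eulerFun {σ : Type} (i : σ) (f : ℕ → ℂ) : Module.End ℂ (MvPolynomial σ ℂ) :=
  (basisMonomials σ ℂ).constr ℂ fun d => monomial d (f (d i))

/-- The operator `f(z_{ij} ∂_i)`, where `z_{ij} = z_i - z_j` and `i ≠ j`. The substitution
`z_i ↦ z_i + z_j` turns `z_{ij} ∂_i` into `z_i ∂_i`. By `relEulerFun_eigen` this operator is the
function `f` of the diagonalizable operator `z_{ij} ∂_i`, whose eigenvalues are `0, 1, 2, …`. -/
def relEulerFun {σ : Type} [DecidableEq σ] (f : ℕ → ℂ) (i j : σ) :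
    Module.End ℂ (MvPolynomial σ ℂ) :=
  (translate i j (-1)).toLinearMap * eulerFun i f * (translate i j 1).toLinearMap

/-- The function `k ↦ Γ(b) Γ(k + a) / (Γ(a) Γ(k + b)) = (a)_k / (b)_k`. -/
def gammaRatio (a b : ℂ) (k : ℕ) : ℂ :=
  (ascPochhammer ℂ k).eval a / (ascPochhammer ℂ k).eval b

/-- `R⁻_{ij}(u) = Γ(2ℓ)/Γ(u+ℓ) · Γ(z_{ij}∂_i + u + ℓ)/Γ(z_{ij}∂_i + 2ℓ)`. -/
def rMinus {σ : Type} [DecidableEq σ] (l u : ℂ) (i j : σ) : Module.End ℂ (MvPolynomial σ ℂ) :=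
  relEulerFun (gammaRatio (u + l) (2 * l)) i j

/-- `R⁺_{ij}(u) = Γ(1+ℓ-u)/Γ(2ℓ) · Γ(z_{ji}∂_j + 2ℓ)/Γ(z_{ji}∂_j + 1 + ℓ - u)`. -/
def rPlus {σ : Type} [DecidableEq σ] (l u : ℂ) (i j : σ) : Module.End ℂ (MvPolynomial σ ℂ) :=
  relEulerFun (gammaRatio (2 * l) (1 + l - u)) j i

/-! In `ℂ[z_0, z_1, …, z_n]`, with variables indexed by `Fin (n + 1)`, the variable `z_0` belongs to
the auxiliary space `V_0`, and `z_{k+1}` (index `k.succ`) is the variable of the site `k : Fin n`. -/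

/-- `P_{10} R⁻_{10}(u + δ_1) ⋯ P_{n0} R⁻_{n0}(u + δ_n)`. -/
def monodromyMinus {n : ℕ} (l δ : Fin n → ℂ) (u : ℂ) :
    Module.End ℂ (MvPolynomial (Fin (n + 1)) ℂ) :=
  (List.ofFn fun k : Fin n => permOp k.succ 0 * rMinus (l k) (u + δ k) k.succ 0).prod

/-- `P_{10} R⁺_{10}(u + δ_1) ⋯ P_{n0} R⁺_{n0}(u + δ_n)`. -/
def monodromyPlus {n : ℕ} (l δ : Fin n → ℂ) (u : ℂ) :
    Module.End ℂ (MvPolynomial (Fin (n + 1)) ℂ) :=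
  (List.ofFn fun k : Fin n => permOp k.succ 0 * rPlus (l k) (u + δ k) k.succ 0).prod

/-- The `m`-th term `(1/m!) ∂_0^m A z_0^m Ψ |_{z_0 = 0}` of the trace over `V_0 = ℂ[z_0]`, that is,
the coefficient of `z_0^m` in `A (z_0^m Ψ)`. -/
def auxTerm {n : ℕ} (A : Module.End ℂ (MvPolynomial (Fin (n + 1)) ℂ)) (m : ℕ)
    (Ψ : MvPolynomial (Fin n) ℂ) : MvPolynomial (Fin n) ℂ :=
  (finSuccEquiv ℂ n (A (X 0 ^ m * rename Fin.succ Ψ))).coeff m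

/-- `B` is the trace of `A` over `V_0`: for every `Ψ` the series `∑ₘ (1/m!) ∂_0^m A z_0^m Ψ |_{z_0 = 0}`
converges to `B Ψ`, coefficient by coefficient. -/
def HasAuxTrace {n : ℕ} (A : Module.End ℂ (MvPolynomial (Fin (n + 1)) ℂ))
    (B : Module.End ℂ (MvPolynomial (Fin n) ℂ)) : Prop :=
  ∀ (Ψ : MvPolynomial (Fin n) ℂ) (d : Fin n →₀ ℕ),
    HasSum (fun m : ℕ => (auxTerm A m Ψ).coeff d) ((B Ψ).coeff d)

/-- The trace of `A` over `V_0` converges. -/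
def AuxTraceConverges {n : ℕ} (A : Module.End ℂ (MvPolynomial (Fin (n + 1)) ℂ)) : Prop :=
  ∃ B : Module.End ℂ (MvPolynomial (Fin n) ℂ), HasAuxTrace A B

open Classical in
/-- The trace of `A` over `V_0` (with the value `0` if it does not converge). -/
def auxTrace {n : ℕ} (A : Module.End ℂ (MvPolynomial (Fin (n + 1)) ℂ)) :
    Module.End ℂ (MvPolynomial (Fin n) ℂ) :=
  if h : AuxTraceConverges A then h.choose else 0

/-- `Q₋(u) = tr_{V_0} P_{10} R⁻_{10}(u + δ_1) ⋯ P_{n0} R⁻_{n0}(u + δ_n)`. -/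
def qMinus {n : ℕ} (l δ : Fin n → ℂ) (u : ℂ) : Module.End ℂ (MvPolynomial (Fin n) ℂ) :=
  auxTrace (monodromyMinus l δ u)

/-- `Q₊(u) = tr_{V_0} P_{10} R⁺_{10}(u + δ_1) ⋯ P_{n0} R⁺_{n0}(u + δ_n)`. -/
def qPlus {n : ℕ} (l δ : Fin n → ℂ) (u : ℂ) : Module.End ℂ (MvPolynomial (Fin n) ℂ) :=
  auxTrace (monodromyPlus l δ u)

/-! Checks of the definitions. -/

theorem hasAuxTrace_auxTrace {n : ℕ} {A : Module.End ℂ (MvPolynomial (Fin (n + 1)) ℂ)}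
    (h : AuxTraceConverges A) : HasAuxTrace A (auxTrace A) := by
  unfold auxTrace
  rw [dif_pos h]
  exact h.choose_spec

theorem HasAuxTrace.auxTrace_eq {n : ℕ} {A : Module.End ℂ (MvPolynomial (Fin (n + 1)) ℂ)}
    {B : Module.End ℂ (MvPolynomial (Fin n) ℂ)} (h : HasAuxTrace A B) : auxTrace A = B := by
  refine LinearMap.ext fun Ψ => MvPolynomial.ext _ _ fun d => ?_
  exact (hasAuxTrace_auxTrace ⟨B, h⟩ Ψ d).unique (h Ψ d)

theorem gammaRatio_eq_Gamma (a b : ℂ) (ha : ∀ j : ℕ, a ≠ -j) (hb : ∀ j : ℕ, b ≠ -j) (k : ℕ) :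
    gammaRatio a b k =
      Complex.Gamma b / Complex.Gamma a * (Complex.Gamma (k + a) / Complex.Gamma (k + b)) := by
  have key : ∀ c : ℂ, (∀ j : ℕ, c ≠ -j) → ∀ k : ℕ,
      Complex.Gamma (k + c) = (ascPochhammer ℂ k).eval c * Complex.Gamma c := by
    intro c hc k
    induction k with
    | zero => simp
    | succ k ih =>
      have h0 : (k : ℂ) + c ≠ 0 := fun h => hc k (by linear_combination h)
      have : ((k + 1 : ℕ) : ℂ) + c = (k + c) + 1 := by push_cast; ring
      rw [this, Complex.Gamma_add_one _ h0, ih, ascPochhammer_succ_eval]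
      ring
  have ga := Complex.Gamma_ne_zero ha
  have gb := Complex.Gamma_ne_zero hb
  rw [key a ha k, key b hb k, gammaRatio, mul_div_mul_comm]
  field_simp

theorem eulerFun_monomial {σ : Type} (i : σ) (f : ℕ → ℂ) (d : σ →₀ ℕ) (c : ℂ) :
    eulerFun i f (monomial d c) = f (d i) • monomial d c := by
  have h : monomial d c = c • (basisMonomials σ ℂ) d := by simp [smul_monomial]
  rw [h, map_smul, eulerFun, Module.Basis.constr_basis]
  simp [smul_monomial, mul_comm]

theorem relEulerFun_eigen {σ : Type} [DecidableEq σ] (f : ℕ → ℂ) {i j : σ} (hij : i ≠ j) (k : ℕ)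
    (Ψ : MvPolynomial σ ℂ) (h : ((mulZ i - mulZ j) * diffZ i) Ψ = (k : ℂ) • Ψ) :
    relEulerFun f i j Ψ = f k • Ψ := by
  have hinv : ∀ p : MvPolynomial σ ℂ, translate i j (-1) (translate i j 1 p) = p := by
    intro p
    induction p using MvPolynomial.induction_on with
    | C a => simp [translate]
    | add p q hp hq => simp [hp, hq]
    | mul_X p s hp =>
      rw [map_mul, map_mul, hp]
      by_cases hs : s = i
      · subst hs; simp [translate, hij.symm]
      · simp [translate, hs]
  have hd : ∀ p : MvPolynomial σ ℂ,
      translate i j 1 (pderiv i p) = pderiv i (translate i j 1 p) := by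
    intro p
    induction p using MvPolynomial.induction_on with
    | C a => simp [translate]
    | add p q hp hq => simp [hp, hq]
    | mul_X p s hp =>
      rw [Derivation.leibniz, map_add, smul_eq_mul, smul_eq_mul, map_mul, map_mul, hp, map_mul,
        Derivation.leibniz, smul_eq_mul, smul_eq_mul]
      by_cases hs : s = i
      · subst hs; simp [translate, pderiv_X_of_ne hij.symm]
      · simp [translate, hs, pderiv_X_of_ne hs]
  have h' : (X i - X j) * pderiv i Ψ = (k : ℂ) • Ψ := by
    simpa [mulZ, diffZ, sub_mul] using h
  have h2 : X i * pderiv i (translate i j 1 Ψ) = (k : ℂ) • translate i j 1 Ψ := by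
    have := congrArg (translate i j 1) h'
    rw [map_mul, hd, map_smul] at this
    rw [← this]
    simp [translate, hij.symm]
  have h3 : ∀ Φ : MvPolynomial σ ℂ, X i * pderiv i Φ = (k : ℂ) • Φ →
      eulerFun i f Φ = f k • Φ := by
    intro Φ hΦ
    have hc : ∀ d, ((d i : ℕ) : ℂ) * Φ.coeff d = k * Φ.coeff d := by
      intro d
      have e1 : ∀ p : MvPolynomial σ ℂ, (X i * pderiv i p).coeff d = (d i : ℂ) * p.coeff d := by
        intro p
        induction p using MvPolynomial.induction_on' with
        | monomial e a =>
          rw [X_mul_pderiv_monomial]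
          simp only [coeff_smul, coeff_monomial]
          split_ifs with hed
          · subst hed; simp
          · simp
        | add p q hp hq => rw [map_add, mul_add, coeff_add, hp, hq, coeff_add]; ring
      rw [← e1, hΦ, coeff_smul, smul_eq_mul]
    conv_lhs => rw [Φ.as_sum]
    conv_rhs => rw [Φ.as_sum]
    rw [map_sum, Finset.smul_sum]
    refine Finset.sum_congr rfl fun d hd' => ?_
    have hne : Φ.coeff d ≠ 0 := MvPolynomial.mem_support_iff.mp hd'
    have : d i = k := by exact_mod_cast mul_right_cancel₀ hne (hc d)
    rw [eulerFun_monomial, this]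
  show translate i j (-1) (eulerFun i f (translate i j 1 Ψ)) = f k • Ψ
  rw [h3 _ h2, map_smul, hinv]

end SpinChain

end

/-! Write `L(u⁺,u⁻)` as `N(z) U N(z)⁻¹` with `N(z)` lower unitriangular and `U` upper triangular
with diagonal `u⁺ - 1`, `u⁻` (`laxOf_eq`). In a product `L_k L_0` the inner unitriangular factors
cancel, and what remains depends only on `x = z_k - z_0`, `∂_k` and the total derivative. A function
`f` of `θ = x∂_k` commutes with the total derivative. If `(θ + b) f(θ + 1) = (θ + a) f(θ)`, as holds
for the quotient of Gamma functions, it exchanges the two minus parameters in `L_k L_0`; this is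
`R⁻`. With the roles of `k` and `0` interchanged one gets `R⁺`, which exchanges the plus parameters
(`laxOf_exchange_minus`, `laxOf_exchange_plus`).

Composed with the permutation `P_{k0}`, this moves `L_0` past `L_k`. Passing through the whole
chain, `L_0` hands one parameter of each site to a neighbour, and because the indices are cyclic it
comes out with the parameters it had at the start. With `A` the monodromy operator the result reads
`A S L_0 = L_0 T A` for `Q₋`, and the mirror image for `Q₊`, where `tr S` and `tr T` are the two
transfer matrices (`chain_minus`, `chain_plus`).

It remains to cancel `L_0` under the trace over `V_0`, which is infinite dimensional, so cyclicity
is not automatic. From `X L_0 = L_0 Y` it follows that `tr X - tr Y` is a combination of a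
commutator with `z_0` and a commutator with `∂_0` (`trace_sub_trace_of_intertwine`). Partial traces
of commutators telescope to one boundary term, with weight `N + 1` in the case of `∂_0`. It tends to
zero if the matrix elements of `A` near the diagonal are `o(1/N)` (`DiagDecay`,
`partialTrace_sub_tendsto_zero`). The argument divides by `u⁺ - 1` and `u⁻` of `L_0`, so finitely
many `u` are excluded at first and recovered by continuity.

For `Q₋` the matrix elements vanish as soon as the outgoing power of `z_0` exceeds the power of
`z_1` in the argument. For `Q₊` they are explicit ratios of Pochhammer symbols of order `O(M^(-Re Σ
2ℓ_k))`, which gives convergence when `Re Σ 2ℓ_k > 1`. Conversely, the diagonal elements on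
constants have exactly this order unless some factor vanishes from some point on; hence existence of
the trace already forces the decay (`diagDecay_monodromyPlus`). -/

noncomputable section

namespace SpinChain

open MvPolynomial

/-! ### Commutation relations among `z_i`, `∂_i`, renamings, functions of `z_i ∂_i` and
translations. -/

section Generators

variable {σ τ : Type}

@[simp]
theorem mulZ_apply (i : σ) (p : MvPolynomial σ ℂ) : mulZ i p = X i * p := rfl

@[simp]
theorem diffZ_apply (i : σ) (p : MvPolynomial σ ℂ) : diffZ i p = pderiv i p := rfl

theorem mulZ_comm (i j : σ) : mulZ i * mulZ j = mulZ j * mulZ i :=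
  LinearMap.ext fun p => by simp [mul_left_comm]

theorem pderiv_pderiv_comm (i j : σ) (p : MvPolynomial σ ℂ) :
    pderiv i (pderiv j p) = pderiv j (pderiv i p) := by
  classical
  ext d
  simp only [coeff_pderiv, Finsupp.add_apply, add_right_comm d, Finsupp.single_apply]
  by_cases h : i = j
  · subst h; rfl
  · simp [h, Ne.symm h]; ring

theorem diffZ_comm (i j : σ) : diffZ i * diffZ j = diffZ j * diffZ i :=
  LinearMap.ext fun p => pderiv_pderiv_comm i j p

theorem diffZ_mulZ_self (i : σ) : diffZ i * mulZ i = mulZ i * diffZ i + 1 :=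
  LinearMap.ext fun p => by simp [Derivation.leibniz]

theorem diffZ_mulZ_of_ne {i j : σ} (h : i ≠ j) : diffZ i * mulZ j = mulZ j * diffZ i :=
  LinearMap.ext fun p => by simp [Derivation.leibniz, pderiv_X_of_ne h.symm]

theorem linearMap_ext_monomial {M : Type} [AddCommMonoid M] [Module ℂ M]
    {A B : MvPolynomial σ ℂ →ₗ[ℂ] M}
    (h : ∀ d c, A (monomial d c) = B (monomial d c)) : A = B :=
  MvPolynomial.linearMap_ext fun d => LinearMap.ext fun c => h d c

/-- The operator that renames the variables along `e`. -/
def renameOp (e : σ → τ) : MvPolynomial σ ℂ →ₗ[ℂ] MvPolynomial τ ℂ :=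
  (rename e : MvPolynomial σ ℂ →ₐ[ℂ] MvPolynomial τ ℂ).toLinearMap

theorem renameOp_mulZ (e : σ → σ) (k : σ) : renameOp e * mulZ k = mulZ (e k) * renameOp e :=
  LinearMap.ext fun p => by simp [renameOp]

theorem renameOp_diffZ {e : σ → σ} (he : Function.Injective e) (k : σ) :
    renameOp e * diffZ k = diffZ (e k) * renameOp e :=
  LinearMap.ext fun p => by simp [renameOp, pderiv_rename he]

theorem eulerFun_mulZ_self (i : σ) (f : ℕ → ℂ) :
    eulerFun i f * mulZ i = mulZ i * eulerFun i (fun m => f (m + 1)) := by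
  refine linearMap_ext_monomial fun d c => ?_
  simp only [Module.End.mul_apply, mulZ_apply, X, monomial_mul, eulerFun_monomial, mul_smul_comm]
  simp [add_comm]

theorem eulerFun_mulZ_of_ne {i k : σ} (h : k ≠ i) (f : ℕ → ℂ) :
    eulerFun i f * mulZ k = mulZ k * eulerFun i f := by
  refine linearMap_ext_monomial fun d c => ?_
  simp only [Module.End.mul_apply, mulZ_apply, X, monomial_mul, eulerFun_monomial, mul_smul_comm]
  simp [h]

theorem diffZ_eulerFun_self (i : σ) (f : ℕ → ℂ) :
    diffZ i * eulerFun i f = eulerFun i (fun m => f (m + 1)) * diffZ i := by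
  refine linearMap_ext_monomial fun d c => ?_
  simp only [Module.End.mul_apply, diffZ_apply, eulerFun_monomial, Derivation.map_smul,
    pderiv_monomial]
  by_cases h : d i = 0
  · simp [h]
  · have : d i - 1 + 1 = d i := by omega
    simp [this]

theorem diffZ_eulerFun_of_ne {i k : σ} (h : k ≠ i) (f : ℕ → ℂ) :
    diffZ k * eulerFun i f = eulerFun i f * diffZ k := by
  refine linearMap_ext_monomial fun d c => ?_
  simp only [Module.End.mul_apply, diffZ_apply, eulerFun_monomial, Derivation.map_smul,
    pderiv_monomial]
  simp [h]

/-- The functional equation of the Gamma quotient in operator form. The exchange relations use no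
other property of the particular function `f`. -/
theorem eulerFun_recursion (i : σ) (f : ℕ → ℂ) (a b : ℂ)
    (h : ∀ m : ℕ, (m + b) * f (m + 1) = (m + a) * f m) :
    (mulZ i * diffZ i + b • 1) * eulerFun i (fun m => f (m + 1)) =
      (mulZ i * diffZ i + a • 1) * eulerFun i f := by
  refine linearMap_ext_monomial fun d c => ?_
  simp only [Module.End.mul_apply, diffZ_apply, mulZ_apply, eulerFun_monomial, LinearMap.add_apply,
    LinearMap.smul_apply, Module.End.one_apply,
    X_mul_pderiv_monomial, smul_monomial, ← map_add]
  congr 1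
  have := h (d i)
  simp only [smul_eq_mul, nsmul_eq_mul]
  linear_combination c * this

variable [DecidableEq σ]

theorem permOp_mulZ (i j k : σ) : permOp i j * mulZ k = mulZ (Equiv.swap i j k) * permOp i j :=
  renameOp_mulZ _ k

theorem permOp_diffZ (i j k : σ) : permOp i j * diffZ k = diffZ (Equiv.swap i j k) * permOp i j :=
  renameOp_diffZ (Equiv.injective _) k

theorem translate_translate {i j : σ} (hij : i ≠ j) (c c' : ℂ) (p : MvPolynomial σ ℂ) :
    translate i j c (translate i j c' p) = translate i j (c + c') p := by
  have : (translate i j c).comp (translate i j c') = translate i j (c + c') := by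
    refine MvPolynomial.algHom_ext fun s => ?_
    by_cases hs : s = i
    · subst hs; simp [translate, hij.symm]; ring
    · simp [translate, hs]
  exact DFunLike.congr_fun this p

theorem translate_zero (i j : σ) (p : MvPolynomial σ ℂ) : translate i j 0 p = p := by
  have : translate i j 0 = AlgHom.id ℂ _ := by
    refine MvPolynomial.algHom_ext fun s => ?_
    by_cases hs : s = i
    · subst hs; simp [translate]
    · simp [translate]
  rw [this]; rfl

/-- The substitution `z_i ↦ z_i + c z_j` as an operator. -/
def translateOp (i j : σ) (c : ℂ) : Module.End ℂ (MvPolynomial σ ℂ) :=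
  (translate i j c).toLinearMap

theorem translateOp_neg_mul {i j : σ} (hij : i ≠ j) (c : ℂ) :
    translateOp i j (-c) * translateOp i j c = 1 :=
  LinearMap.ext fun p => by simp [translateOp, translate_translate hij, translate_zero]

theorem translateOp_mulZ_self (i j : σ) (c : ℂ) :
    translateOp i j c * mulZ i = (mulZ i + c • mulZ j) * translateOp i j c :=
  LinearMap.ext fun p => by simp [translateOp, translate, add_mul, C_mul']

theorem translateOp_mulZ_of_ne {i k : σ} (h : k ≠ i) (j : σ) (c : ℂ) :
    translateOp i j c * mulZ k = mulZ k * translateOp i j c :=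
  LinearMap.ext fun p => by simp [translateOp, translate, h]

theorem diffZ_translateOp {i j : σ} (hij : i ≠ j) (c : ℂ) (k : σ) :
    diffZ k * translateOp i j c =
      translateOp i j c * (diffZ k + (if k = j then c else 0) • diffZ i) := by
  refine LinearMap.ext fun p => ?_
  simp only [Module.End.mul_apply, diffZ_apply, translateOp, AlgHom.toLinearMap_apply,
    LinearMap.add_apply, LinearMap.smul_apply]
  induction p using MvPolynomial.induction_on with
  | C a => simp [translate]
  | add p q hp hq => simp only [map_add, hp, hq, smul_add]; abel
  | mul_X p s hp =>
    simp only [Derivation.leibniz, smul_eq_mul, map_mul, map_add, hp, map_smul, smul_add, mul_add]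
    have key : pderiv k (translate i j c (X s)) =
        translate i j c (pderiv k (X s)) +
          (if k = j then c else 0) • translate i j c (pderiv i (X s)) := by
      by_cases hs : s = i
      · subst hs
        by_cases hk : k = j
        · subst hk; simp [translate, Derivation.leibniz, pderiv_X_of_ne hij, Algebra.smul_def]
        · by_cases hk' : k = s
          · subst hk'; simp [translate, Derivation.leibniz, hk, pderiv_X_of_ne (Ne.symm hk)]
          · simp [translate, Derivation.leibniz, hk, pderiv_X_of_ne (Ne.symm hk),
              pderiv_X_of_ne (Ne.symm hk')]
      · by_cases hk : s = k
        · subst hk; simp [translate, hs, pderiv_X_of_ne hs]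
        · simp [translate, hs, pderiv_X_of_ne hs, pderiv_X_of_ne hk]
    rw [key, mul_add, mul_smul_comm, mul_smul_comm]
    abel

end Generators

/-! ### Commutation relations of `f(z_{ij} ∂_i)`. -/

section RelEulerFun

variable {σ : Type} [DecidableEq σ] (f : ℕ → ℂ) {i j : σ}

theorem relEulerFun_eq : relEulerFun f i j =
    translateOp i j (-1) * eulerFun i f * translateOp i j 1 := rfl

/-- The translation carries `z_{ij}` to `z_i`, fixes `∂_i` and carries `∂_i + ∂_j` to `∂_j`. It is
invertible, so each relation below is pulled back from the one for `f(z_i ∂_i)` by cancelling it on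
the left. -/
theorem translateOp_mul_relEulerFun (hij : i ≠ j) :
    translateOp i j 1 * relEulerFun f i j = eulerFun i f * translateOp i j 1 := by
  have := translateOp_neg_mul hij (-1)
  rw [neg_neg] at this
  rw [relEulerFun_eq, ← mul_assoc, ← mul_assoc, this, one_mul]

theorem translateOp_injective (hij : i ≠ j) {A B : Module.End ℂ (MvPolynomial σ ℂ)}
    (h : translateOp i j 1 * A = translateOp i j 1 * B) : A = B := by
  have := congrArg (translateOp i j (-1) * ·) h
  simpa only [← mul_assoc, translateOp_neg_mul hij, one_mul] using this

theorem relEulerFun_mulZ_of_ne {k : σ} (hk : k ≠ i) :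
    relEulerFun f i j * mulZ k = mulZ k * relEulerFun f i j := by
  simp only [relEulerFun_eq, mul_assoc, translateOp_mulZ_of_ne hk]
  rw [← mul_assoc (eulerFun i f), eulerFun_mulZ_of_ne hk]
  simp only [← mul_assoc, translateOp_mulZ_of_ne hk]

theorem relEulerFun_diffZ_of_ne (hij : i ≠ j) {k : σ} (hk : k ≠ i) (hk' : k ≠ j) :
    relEulerFun f i j * diffZ k = diffZ k * relEulerFun f i j := by
  have h1 := diffZ_translateOp hij 1 k
  have h2 := diffZ_translateOp hij (-1) k
  simp only [hk', if_false, zero_smul, add_zero] at h1 h2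
  simp only [relEulerFun_eq]
  rw [← mul_assoc, ← mul_assoc, h2, mul_assoc, ← h1, mul_assoc (translateOp i j (-1)) (diffZ k),
    diffZ_eulerFun_of_ne hk]
  simp only [mul_assoc]

theorem relEulerFun_mulZ_sub (hij : i ≠ j) :
    relEulerFun f i j * (mulZ i - mulZ j) =
      (mulZ i - mulZ j) * relEulerFun (fun m => f (m + 1)) i j := by
  have h : translateOp i j 1 * (mulZ i - mulZ j) = mulZ i * translateOp i j 1 := by
    rw [mul_sub, translateOp_mulZ_self, translateOp_mulZ_of_ne hij.symm, one_smul, add_mul,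
      add_sub_cancel_right]
  apply translateOp_injective hij
  rw [← mul_assoc, translateOp_mul_relEulerFun f hij, mul_assoc, h, ← mul_assoc,
    eulerFun_mulZ_self, ← mul_assoc, h, mul_assoc, mul_assoc, translateOp_mul_relEulerFun _ hij]

theorem translateOp_diffZ_self (hij : i ≠ j) :
    translateOp i j 1 * diffZ i = diffZ i * translateOp i j 1 := by
  rw [diffZ_translateOp hij, if_neg hij, zero_smul, add_zero]

theorem diffZ_relEulerFun (hij : i ≠ j) :
    diffZ i * relEulerFun f i j = relEulerFun (fun m => f (m + 1)) i j * diffZ i := by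
  apply translateOp_injective hij
  rw [← mul_assoc, translateOp_diffZ_self hij, mul_assoc, translateOp_mul_relEulerFun f hij,
    ← mul_assoc, ← mul_assoc, translateOp_mul_relEulerFun _ hij, diffZ_eulerFun_self, mul_assoc,
    mul_assoc, translateOp_diffZ_self hij]

theorem relEulerFun_diffZ_add (hij : i ≠ j) :
    relEulerFun f i j * (diffZ i + diffZ j) = (diffZ i + diffZ j) * relEulerFun f i j := by
  have h : translateOp i j 1 * (diffZ i + diffZ j) = diffZ j * translateOp i j 1 := by
    rw [diffZ_translateOp hij, if_pos rfl, one_smul, add_comm]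
  apply translateOp_injective hij
  rw [← mul_assoc, translateOp_mul_relEulerFun f hij, mul_assoc, h, ← mul_assoc,
    ← diffZ_eulerFun_of_ne hij.symm, ← mul_assoc, h, mul_assoc, mul_assoc,
    translateOp_mul_relEulerFun _ hij]

theorem relEulerFun_recursion (hij : i ≠ j) (a b : ℂ)
    (h : ∀ m : ℕ, (m + b) * f (m + 1) = (m + a) * f m) :
    ((mulZ i - mulZ j) * diffZ i + b • 1) * relEulerFun (fun m => f (m + 1)) i j =
      ((mulZ i - mulZ j) * diffZ i + a • 1) * relEulerFun f i j := by
  have hx : translateOp i j 1 * (mulZ i - mulZ j) = mulZ i * translateOp i j 1 := by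
    rw [mul_sub, translateOp_mulZ_self, translateOp_mulZ_of_ne hij.symm, one_smul, add_mul,
      add_sub_cancel_right]
  have ht : ∀ c : ℂ, translateOp i j 1 * ((mulZ i - mulZ j) * diffZ i + c • 1) =
      (mulZ i * diffZ i + c • 1) * translateOp i j 1 := by
    intro c
    rw [mul_add, ← mul_assoc, hx, mul_assoc, translateOp_diffZ_self hij]
    simp only [mul_smul_comm, smul_mul_assoc, add_mul, mul_one, one_mul, mul_assoc]
  apply translateOp_injective hij
  rw [← mul_assoc, ht, mul_assoc, translateOp_mul_relEulerFun _ hij, ← mul_assoc,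
    eulerFun_recursion i f a b h, ← mul_assoc, ht, mul_assoc, mul_assoc,
    translateOp_mul_relEulerFun _ hij]

end RelEulerFun

theorem gammaRatio_recursion (a b : ℂ) (hb : ∀ j : ℕ, b ≠ -j) (m : ℕ) :
    (m + b) * gammaRatio a b (m + 1) = (m + a) * gammaRatio a b m := by
  have h0 : (m : ℂ) + b ≠ 0 := fun h => hb m (by linear_combination h)
  have h0' : b + (m : ℂ) ≠ 0 := by rwa [add_comm]
  rw [gammaRatio, gammaRatio, ascPochhammer_succ_eval, ascPochhammer_succ_eval]
  field_simp
  ring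

end SpinChain

namespace SpinChain

open MvPolynomial

/-! ### Factorization of Lax matrices over a ring, and the exchange of their parameters. -/

section AbstractLax

variable {R : Type} [Ring R]

/-- The lower triangular factor of a Lax matrix. -/
def lowerTri (z : R) : Matrix (Fin 2) (Fin 2) R := !![1, 0; z, 1]

theorem lowerTri_mul (z w : R) : lowerTri z * lowerTri w = lowerTri (z + w) := by
  simp [lowerTri]

theorem lowerTri_zero : lowerTri (0 : R) = 1 := by
  simp [lowerTri, Matrix.one_fin_two]

theorem scalar_mul_fin_two (r a b c d : R) :
    Matrix.scalar (Fin 2) r * !![a, b; c, d] = !![r * a, r * b; r * c, r * d] := by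
  ext i j; fin_cases i <;> fin_cases j <;> simp [Matrix.scalar_apply]

theorem fin_two_mul_scalar (r a b c d : R) :
    !![a, b; c, d] * Matrix.scalar (Fin 2) r = !![a * r, b * r; c * r, d * r] := by
  ext i j; fin_cases i <;> fin_cases j <;> simp [Matrix.scalar_apply]

theorem scalar_commute_lowerTri {r z : R} (h : r * z = z * r) :
    Matrix.scalar (Fin 2) r * lowerTri z = lowerTri z * Matrix.scalar (Fin 2) r := by
  rw [lowerTri, scalar_mul_fin_two, fin_two_mul_scalar]
  simp [h]

variable [Algebra ℂ R]

/-- The upper triangular factor of a Lax matrix. -/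
def upperTri (d : R) (up um : ℂ) : Matrix (Fin 2) (Fin 2) R :=
  !![(up - 1) • 1, -d; 0, um • 1]

/-- The Lax matrix built from elements `z`, `d` of a ring. -/
def laxOf (z d : R) (up um : ℂ) : Matrix (Fin 2) (Fin 2) R :=
  !![up • 1 + z * d, -d; z ^ 2 * d + (up - um) • z, um • 1 - z * d]

/-- The two parameters separate onto the diagonal of the triangular factor; the shift `up - 1` there
comes from reordering `d * z`. -/
theorem laxOf_eq {z d : R} (h : d * z = z * d + 1) (up um : ℂ) :
    laxOf z d up um = lowerTri z * upperTri d up um * lowerTri (-z) := by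
  have h' : z * (d * z) = z * (z * d) + z := by rw [h, mul_add, mul_one]
  simp only [laxOf, lowerTri, upperTri, Matrix.mul_fin_two]
  ext i j
  fin_cases i <;> fin_cases j
  · simp [h]; module
  · simp
  · simp [mul_assoc, h', add_mul, pow_two]; module
  · simp; module

section Exchange

variable {x d s r r' : R} {a b : ℂ} (hdx : d * x = x * d + 1) (hrx : r * x = x * r')
  (hdr : d * r = r' * d) (hrec : (x * d + b • 1) * r' = (x * d + a • 1) * r)
  (hrs : r * s = s * r)

-- Here and below `r` stands for `f(θ)` and `r'` for `f(θ + 1)`, with `θ = x * d`; the hypotheses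
-- are the relations that these satisfy, and `s` plays the total derivative.
omit [Algebra ℂ R] in
include hdr hrx in
theorem exchange_theta : r * (x * d) = x * d * r := by
  rw [← mul_assoc, hrx, mul_assoc, ← hdr, mul_assoc]

omit [Algebra ℂ R] in
include hdx hdr hrx in
theorem exchange_theta' : r' * (x * d) = x * d * r' := by
  have : r' * (d * x) = d * x * r' := by rw [← mul_assoc, ← hdr, mul_assoc, hrx, mul_assoc]
  rw [hdx, mul_add, add_mul, mul_one, one_mul] at this
  exact add_right_cancel this

include hdx hdr hrx hrec in
theorem exchange_raise : r * (x ^ 2 * d + b • x) = (x ^ 2 * d + a • x) * r := by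
  have h1 : ∀ c : ℂ, x ^ 2 * d + c • x = x * (x * d + c • 1) := by
    intro c; simp [pow_two, mul_add, mul_assoc]
  have h2 : r' * (x * d + b • 1) = (x * d + b • 1) * r' := by
    rw [mul_add, add_mul, exchange_theta' hdx hrx hdr]; simp
  rw [h1, h1, ← mul_assoc, hrx, mul_assoc, h2, hrec, mul_assoc]

include hdr hrx hrec in
theorem exchange_lower : r * ((x * d + a • 1) * d) = (x * d + b • 1) * d * r := by
  have h2 : r * (x * d + a • 1) = (x * d + a • 1) * r := by
    rw [mul_add, add_mul, exchange_theta hrx hdr]; simp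
  rw [← mul_assoc, h2, ← hrec, mul_assoc, ← hdr, mul_assoc]

omit [Algebra ℂ R] in
include hdx in
theorem sq_mul_lower : x ^ 2 * d * d = x * d * (x * d) - x * d := by
  have : x * d * (x * d) = x * (d * x) * d := by simp only [mul_assoc]
  rw [this, hdx]; simp [mul_add, add_mul, pow_two, mul_assoc]

-- The point of this normal form is that `um` and `vm` enter only through symmetric expressions and
-- through `up - um` and `up - vm`. Exchanging them therefore amounts to exchanging `a` and `b` in
-- the raising term `x ^ 2 * d + b • x` and the lowering term `(x * d + a • 1) * d`, which is what
-- conjugation by `r` does.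
include hdx in
theorem laxOf_mul_upperTri (up um vp vm : ℂ) :
    laxOf x d up um * upperTri (s - d) vp vm =
      !![(vp - 1) • (up • 1 + x * d), (x * d + (up - vm) • 1) * d - (x * d * s + up • s);
        (vp - 1) • (x ^ 2 * d + (up - um) • x),
        x * d * (x * d) + (up - um - vm - 1) • (x * d) + (um * vm) • 1
          - (x ^ 2 * d + (up - um) • x) * s] := by
  rw [laxOf, upperTri, Matrix.mul_fin_two]
  ext i j
  fin_cases i <;> fin_cases j
  · simp
  · simp [mul_sub, add_mul]; module
  · simp
  · have := sq_mul_lower hdx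
    simp [mul_sub, add_mul, this]; module

-- The mirror image: `up` and `vp` enter symmetrically except in the lowering and the raising term.
-- In particular `(up - 1) * vp + vp` is just `up * vp`.
include hdx in
theorem upperTri_mul_laxOf (up um vp vm : ℂ) :
    upperTri (s - d) up um * laxOf x d vp vm =
      !![x * d * (x * d) + (up + vp - vm) • (x * d) + ((up - 1) * vp + vp - vm) • 1
          - s * (x ^ 2 * d + (vp - vm) • x),
        s * (x * d) - vm • s - (x * d + (up - vm) • 1) * d;
        um • (x ^ 2 * d + (vp - vm) • x), um • (vm • 1 - x * d)] := by
  have h2 : d * (x ^ 2 * d) = x * d * (x * d) + x * d := by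
    rw [pow_two, mul_assoc, ← mul_assoc d, hdx, add_mul, one_mul, mul_assoc]
  have h3 : d * (x * d) = x * d * d + d := by rw [← mul_assoc, hdx, add_mul, one_mul]
  rw [laxOf, upperTri, Matrix.mul_fin_two]
  ext i j
  fin_cases i <;> fin_cases j
  · simp [sub_mul, mul_add, h2, hdx]; module
  · simp [sub_mul, add_mul, mul_sub, h3]; module
  · simp
  · simp

include hdx hdr hrx hrec hrs in
theorem exchange_minus (up um vp vm : ℂ) (ha : a = up - vm) (hb : b = up - um) :
    Matrix.scalar (Fin 2) r * (laxOf x d up um * upperTri (s - d) vp vm) =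
      laxOf x d up vm * upperTri (s - d) vp um * Matrix.scalar (Fin 2) r := by
  have hθ := exchange_theta hrx hdr
  have hraise := exchange_raise hdx hrx hdr hrec
  have hlow := exchange_lower hrx hdr hrec
  have hθs : r * (x * d * s) = x * d * s * r := by
    rw [← mul_assoc, hθ, mul_assoc, hrs, mul_assoc, mul_assoc, mul_assoc]
  have hraise' : r * ((x ^ 2 * d + b • x) * s) = (x ^ 2 * d + a • x) * s * r := by
    rw [← mul_assoc, hraise, mul_assoc, hrs, mul_assoc]
  have hθ2 : r * (x * d * (x * d)) = x * d * (x * d) * r := by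
    rw [← mul_assoc, hθ, mul_assoc, hθ, mul_assoc]; simp only [mul_assoc]
  have e : a - um - 1 = b - vm - 1 := by rw [ha, hb]; ring
  rw [laxOf_mul_upperTri hdx, laxOf_mul_upperTri hdx, scalar_mul_fin_two, fin_two_mul_scalar,
    ← ha, ← hb]
  have e11 : r * ((vp - 1) • (up • 1 + x * d)) = (vp - 1) • (up • 1 + x * d) * r := by
    simp only [mul_smul_comm, mul_add, smul_mul_assoc, add_mul, one_mul, mul_one, hθ]
  have e12 : r * ((x * d + a • 1) * d - (x * d * s + up • s)) =
      ((x * d + b • 1) * d - (x * d * s + up • s)) * r := by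
    rw [mul_sub, sub_mul, hlow, mul_add r (x * d * s), hθs, mul_smul_comm, hrs,
      add_mul (x * d * s), smul_mul_assoc]
  have e21 : r * ((vp - 1) • (x ^ 2 * d + b • x)) = (vp - 1) • (x ^ 2 * d + a • x) * r := by
    rw [mul_smul_comm, hraise, smul_mul_assoc]
  have e22 : r * (x * d * (x * d) + (b - vm - 1) • (x * d) + (um * vm) • 1
        - (x ^ 2 * d + b • x) * s) =
      (x * d * (x * d) + (b - vm - 1) • (x * d) + (um * vm) • 1
        - (x ^ 2 * d + a • x) * s) * r := by
    rw [mul_sub, sub_mul, hraise']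
    congr 1
    simp only [mul_smul_comm, smul_mul_assoc, one_mul, mul_one, hθ, mul_add, add_mul, hθ2]
  rw [e11, e12, e21, e22, e, mul_comm um vm]

include hdx hdr hrx hrec hrs in
theorem exchange_plus (up um vp vm : ℂ) (ha : a = vp - vm) (hb : b = up - vm) :
    upperTri (s - d) up um * laxOf x d vp vm * Matrix.scalar (Fin 2) r =
      Matrix.scalar (Fin 2) r * (upperTri (s - d) vp um * laxOf x d up vm) := by
  have hθ := exchange_theta hrx hdr
  have hraise := exchange_raise hdx hrx hdr hrec
  have hlow := exchange_lower hrx hdr hrec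
  have hθs : s * (x * d) * r = r * (s * (x * d)) := by
    rw [mul_assoc, ← hθ, ← mul_assoc, ← hrs, mul_assoc]
  have hraise' : s * (x ^ 2 * d + a • x) * r = r * (s * (x ^ 2 * d + b • x)) := by
    rw [mul_assoc, ← hraise, ← mul_assoc, ← hrs, mul_assoc]
  have hθ2 : x * d * (x * d) * r = r * (x * d * (x * d)) := by
    rw [mul_assoc, ← hθ, ← mul_assoc, ← hθ, mul_assoc]
  have e : up + vp - vm = vp + up - vm := by ring
  have e' : (up - 1) * vp + vp - vm = (vp - 1) * up + up - vm := by ring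
  rw [upperTri_mul_laxOf hdx, upperTri_mul_laxOf hdx, scalar_mul_fin_two, fin_two_mul_scalar,
    ← ha, ← hb]
  have e11 : (x * d * (x * d) + (up + vp - vm) • (x * d) + ((up - 1) * vp + vp - vm) • 1
        - s * (x ^ 2 * d + a • x)) * r =
      r * (x * d * (x * d) + (up + vp - vm) • (x * d) + ((up - 1) * vp + vp - vm) • 1
        - s * (x ^ 2 * d + b • x)) := by
    rw [mul_sub, sub_mul, hraise']
    congr 1
    simp only [mul_smul_comm, smul_mul_assoc, one_mul, mul_one, hθ, mul_add, add_mul, hθ2]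
  have e12 : (s * (x * d) - vm • s - (x * d + b • 1) * d) * r =
      r * (s * (x * d) - vm • s - (x * d + a • 1) * d) := by
    rw [mul_sub, sub_mul, hlow, mul_sub, sub_mul, hθs, mul_smul_comm, smul_mul_assoc, hrs]
  have e21 : um • (x ^ 2 * d + a • x) * r = r * (um • (x ^ 2 * d + b • x)) := by
    rw [mul_smul_comm, hraise, smul_mul_assoc]
  have e22 : um • (vm • 1 - x * d) * r = r * (um • (vm • 1 - x * d)) := by
    simp only [mul_smul_comm, mul_sub, smul_mul_assoc, sub_mul, one_mul, mul_one, hθ]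
  rw [e11, e12, e21, e22, e, e']

variable {z : R} (hdz : d * z = z * d) (hsz : (s - d) * z = z * (s - d) + 1)
  (hrz : r * z = z * r)

include hdx hdz in
theorem laxOf_add (up um : ℂ) :
    laxOf (x + z) d up um = lowerTri z * laxOf x d up um * lowerTri (-z) := by
  have h : d * (x + z) = (x + z) * d + 1 := by rw [mul_add, hdx, hdz, add_mul]; abel
  rw [laxOf_eq hdx, laxOf_eq h, add_comm, ← lowerTri_mul, neg_add_rev, ← lowerTri_mul]
  simp only [mul_assoc]

-- Both Lax matrices are conjugated by the same `lowerTri z`. The inner factors cancel, the outer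
-- ones commute with `r`, and the case `z = 0` of `exchange_minus` is left.
include hdx hdr hrx hrec hrs hdz hsz hrz in
theorem laxOf_exchange_minus (up um vp vm : ℂ) (ha : a = up - vm) (hb : b = up - um) :
    Matrix.scalar (Fin 2) r * (laxOf (x + z) d up um * laxOf z (s - d) vp vm) =
      laxOf (x + z) d up vm * laxOf z (s - d) vp um * Matrix.scalar (Fin 2) r := by
  have hinv : lowerTri (-z) * lowerTri z = 1 := by
    rw [lowerTri_mul, neg_add_cancel, lowerTri_zero]
  have key : ∀ u v w t : ℂ, laxOf (x + z) d u v * laxOf z (s - d) w t =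
      lowerTri z * (laxOf x d u v * upperTri (s - d) w t) * lowerTri (-z) := by
    intro u v w t
    rw [laxOf_add hdx hdz, laxOf_eq hsz]
    simp only [mul_assoc]
    rw [← mul_assoc (lowerTri (-z)) (lowerTri z), hinv, one_mul]
  have hrz' : r * -z = -z * r := by simp [hrz]
  rw [key, key, mul_assoc (lowerTri z * _), ← scalar_commute_lowerTri hrz', ← mul_assoc,
    ← mul_assoc, scalar_commute_lowerTri hrz, mul_assoc (lowerTri z),
    exchange_minus hdx hrx hdr hrec hrs up um vp vm ha hb]
  simp only [mul_assoc]

include hdx hdr hrx hrec hrs hdz hsz hrz in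
theorem laxOf_exchange_plus (up um vp vm : ℂ) (ha : a = vp - vm) (hb : b = up - vm) :
    laxOf z (s - d) up um * laxOf (x + z) d vp vm * Matrix.scalar (Fin 2) r =
      Matrix.scalar (Fin 2) r * (laxOf z (s - d) vp um * laxOf (x + z) d up vm) := by
  have hinv : lowerTri (-z) * lowerTri z = 1 := by
    rw [lowerTri_mul, neg_add_cancel, lowerTri_zero]
  have key : ∀ u v w t : ℂ, laxOf z (s - d) w t * laxOf (x + z) d u v =
      lowerTri z * (upperTri (s - d) w t * laxOf x d u v) * lowerTri (-z) := by
    intro u v w t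
    rw [laxOf_add hdx hdz, laxOf_eq hsz]
    simp only [mul_assoc]
    rw [← mul_assoc (lowerTri (-z)) (lowerTri z), hinv, one_mul]
  have hrz' : r * -z = -z * r := by simp [hrz]
  have h := exchange_plus hdx hrx hdr hrec hrs up um vp vm ha hb
  rw [key, key, mul_assoc (lowerTri z * _), ← scalar_commute_lowerTri hrz', ← mul_assoc,
    mul_assoc (lowerTri z), h, ← mul_assoc, ← scalar_commute_lowerTri hrz]
  simp only [mul_assoc]

end Exchange

omit [Algebra ℂ R] in
theorem lowerTri_conj_one_zero (z : R) (Y : Matrix (Fin 2) (Fin 2) R) :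
    (lowerTri (-z) * Y * lowerTri z) 1 0 = Y 1 0 + Y 1 1 * z - z * (Y 0 0 + Y 0 1 * z) := by
  rw [Y.eta_fin_two]
  simp [lowerTri]
  noncomm_ring

/-- The substitute for "`X = L Y L⁻¹`, hence equal traces" when entries do not commute: the defect
is a sum of commutators with `z` and `d`, whose partial traces over `V_0` telescope. After
conjugation by `lowerTri z` the Lax matrix is triangular, and three entries of the relation suffice.
-/
theorem trace_sub_trace_of_intertwine {z d : R} (h : d * z = z * d + 1) (up : ℂ) {um : ℂ}
    (hum : um ≠ 0) {X Y : Matrix (Fin 2) (Fin 2) R} (hXY : X * laxOf z d up um = laxOf z d up um * Y) :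
    (up - 1) • (X.trace - Y.trace) =
      (up - 1) • ((Y 0 1 - X 0 1) * z - z * (Y 0 1 - X 0 1)) +
        ((lowerTri (-z) * Y * lowerTri z) 1 0 * d - d * (lowerTri (-z) * Y * lowerTri z) 1 0) := by
  have hinv : lowerTri z * lowerTri (-z) = 1 := by
    rw [lowerTri_mul, add_neg_cancel, lowerTri_zero]
  have hinv' : lowerTri (-z) * lowerTri z = 1 := by
    rw [lowerTri_mul, neg_add_cancel, lowerTri_zero]
  set A := lowerTri (-z) * X * lowerTri z with hA
  set B := lowerTri (-z) * Y * lowerTri z with hB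
  have hAB : A * upperTri d up um = upperTri d up um * B := by
    rw [laxOf_eq h] at hXY
    calc A * upperTri d up um
        = lowerTri (-z) * (X * (lowerTri z * upperTri d up um * lowerTri (-z))) * lowerTri z := by
          simp only [hA, mul_assoc, hinv', mul_one]
      _ = upperTri d up um * B := by
          rw [hXY]
          simp only [hB, mul_assoc]
          rw [← mul_assoc (lowerTri (-z)) (lowerTri z), hinv', one_mul]
  -- Over a noncommutative ring conjugation changes the trace, here by a commutator with `z`.
  have tA : A 0 0 + A 1 1 = X.trace + (X 0 1 * z - z * X 0 1) := by
    rw [hA, X.eta_fin_two]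
    simp [lowerTri, Matrix.trace]; abel
  have tB : B 0 0 + B 1 1 = Y.trace + (Y 0 1 * z - z * Y 0 1) := by
    rw [hB, Y.eta_fin_two]
    simp [lowerTri, Matrix.trace]; abel
  have e11 := congrFun (congrFun hAB 0) 0
  have e21 := congrFun (congrFun hAB 1) 0
  have e22 := congrFun (congrFun hAB 1) 1
  simp only [upperTri, Matrix.mul_apply, Fin.sum_univ_two, Matrix.of_apply, Matrix.cons_val',
    Matrix.cons_val, mul_smul_comm, smul_mul_assoc, mul_one, one_mul, mul_zero, zero_mul, add_zero,
    zero_add, mul_neg, neg_mul] at e11 e21 e22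
  have h1 : (up - 1) • (A 0 0 - B 0 0) = -(d * B 1 0) := by rw [smul_sub, e11]; abel
  -- The `(1, 1)` entry gives `um • (A 1 1 - B 1 1) = A 1 0 * d`, and the `(1, 0)` entry gives `(up
  -- - 1) • A 1 0 = um • B 1 0`; so `um` cancels and both diagonal defects involve the same `B 1 0`.
  have h2 : (up - 1) • (A 1 1 - B 1 1) = B 1 0 * d := by
    have : um • (A 1 1 - B 1 1) = A 1 0 * d := by rw [smul_sub, ← e22]; abel
    apply smul_right_injective R hum
    dsimp only
    rw [smul_comm, this, ← smul_mul_assoc, e21, smul_mul_assoc]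
  have h3 : X.trace - Y.trace =
      (Y 0 1 - X 0 1) * z - z * (Y 0 1 - X 0 1) + ((A 0 0 - B 0 0) + (A 1 1 - B 1 1)) := by
    have : X.trace - Y.trace = (A 0 0 + A 1 1 - (X 0 1 * z - z * X 0 1)) -
      (B 0 0 + B 1 1 - (Y 0 1 * z - z * Y 0 1)) := by rw [tA, tB]; abel
    rw [this, sub_mul, mul_sub]; abel
  rw [h3, smul_add, smul_add _ (A 0 0 - B 0 0), h1, h2]
  abel

end AbstractLax

end SpinChain

namespace SpinChain

open MvPolynomial

/-! ### Exchange relations for a site and the auxiliary space. -/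

section LocalRelations

variable {σ : Type}

theorem scalar_mul_lax_of_intertwine {A : Module.End ℂ (MvPolynomial σ ℂ)} {i j : σ}
    (hz : A * mulZ i = mulZ j * A) (hd : A * diffZ i = diffZ j * A) (up um : ℂ) :
    Matrix.scalar (Fin 2) A * lax i up um = lax j up um * Matrix.scalar (Fin 2) A := by
  have hzd : A * (mulZ i * diffZ i) = mulZ j * diffZ j * A := by
    rw [← mul_assoc, hz, mul_assoc, hd, mul_assoc]
  have hz2 : A * (mulZ i ^ 2 * diffZ i) = mulZ j ^ 2 * diffZ j * A := by
    rw [pow_two, mul_assoc, ← mul_assoc, hz, mul_assoc, hzd]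
    simp only [pow_two, mul_assoc]
  have hn : A * -diffZ i = -diffZ j * A := by
    refine (mul_neg A (diffZ i)).trans ?_
    rw [hd]
    exact (neg_mul (diffZ j) A).symm
  rw [lax, lax, scalar_mul_fin_two, fin_two_mul_scalar]
  simp only [mul_add, mul_sub, add_mul, sub_mul, mul_smul_comm, smul_mul_assoc, mul_one, one_mul,
    hn, hz, hzd, hz2]

variable [DecidableEq σ] {k o : σ}

theorem scalar_rMinus_mul_lax (hko : k ≠ o) {l u up um : ℂ} (vp : ℂ) {vm : ℂ}
    (hl : ∀ j : ℕ, 2 * l ≠ -(j : ℂ)) (ha : u + l = up - vm) (hb : 2 * l = up - um) :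
    Matrix.scalar (Fin 2) (rMinus l u k o) * (lax k up um * lax o vp vm) =
      lax k up vm * lax o vp um * Matrix.scalar (Fin 2) (rMinus l u k o) := by
  -- With base point `z_o` the left matrix is `laxOf (x + z) d` and the right one is `laxOf z (s -
  -- d)`.
  have h := laxOf_exchange_minus (x := mulZ k - mulZ o) (d := diffZ k) (z := mulZ o)
    (s := diffZ k + diffZ o) (r := rMinus l u k o)
    (by rw [mul_sub, diffZ_mulZ_self, diffZ_mulZ_of_ne hko, sub_mul]; abel)
    (relEulerFun_mulZ_sub _ hko) (diffZ_relEulerFun _ hko)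
    (relEulerFun_recursion _ hko _ _ (gammaRatio_recursion _ _ hl))
    (relEulerFun_diffZ_add _ hko) (diffZ_mulZ_of_ne hko)
    (by rw [add_sub_cancel_left, diffZ_mulZ_self])
    (relEulerFun_mulZ_of_ne _ hko.symm) up um vp vm ha hb
  rwa [sub_add_cancel, add_sub_cancel_left] at h

theorem lax_mul_scalar_rPlus (hko : k ≠ o) {l u up vp vm : ℂ} (um : ℂ)
    (hl : ∀ j : ℕ, 1 + l - u ≠ -(j : ℂ)) (ha : 2 * l = vp - vm) (hb : 1 + l - u = up - vm) :
    lax k up um * lax o vp vm * Matrix.scalar (Fin 2) (rPlus l u k o) =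
      Matrix.scalar (Fin 2) (rPlus l u k o) * (lax k vp um * lax o up vm) := by
  -- Now the base point is `z_k`, and the matrix that depends on `x` stands on the right.
  have h := laxOf_exchange_plus (x := mulZ o - mulZ k) (d := diffZ o) (z := mulZ k)
    (s := diffZ o + diffZ k) (r := rPlus l u k o)
    (by rw [mul_sub, diffZ_mulZ_self, diffZ_mulZ_of_ne hko.symm, sub_mul]; abel)
    (relEulerFun_mulZ_sub _ hko.symm) (diffZ_relEulerFun _ hko.symm)
    (relEulerFun_recursion _ hko.symm _ _ (gammaRatio_recursion _ _ hl))
    (relEulerFun_diffZ_add _ hko.symm) (diffZ_mulZ_of_ne hko.symm)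
    (by rw [add_sub_cancel_left, diffZ_mulZ_self])
    (relEulerFun_mulZ_of_ne _ hko) up um vp vm ha hb
  rwa [sub_add_cancel, add_sub_cancel_left] at h

theorem permOp_mul_lax_left (up um : ℂ) : Matrix.scalar (Fin 2) (permOp k o) * lax k up um =
    lax o up um * Matrix.scalar (Fin 2) (permOp k o) :=
  scalar_mul_lax_of_intertwine (by simp [permOp_mulZ]) (by simp [permOp_diffZ]) up um

theorem permOp_mul_lax_right (up um : ℂ) : Matrix.scalar (Fin 2) (permOp k o) * lax o up um =
    lax k up um * Matrix.scalar (Fin 2) (permOp k o) :=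
  scalar_mul_lax_of_intertwine (by simp [permOp_mulZ]) (by simp [permOp_diffZ]) up um

/-- The operator `P_{ko} R⁻_{ko}(u)`. -/
def siteMinus (l u : ℂ) (k o : σ) : Module.End ℂ (MvPolynomial σ ℂ) :=
  permOp k o * rMinus l u k o

/-- The operator `P_{ko} R⁺_{ko}(u)`. -/
def sitePlus (l u : ℂ) (k o : σ) : Module.End ℂ (MvPolynomial σ ℂ) :=
  permOp k o * rPlus l u k o

/-- The auxiliary Lax matrix moves from the right of the site to its left; it keeps its minus
parameter and trades its plus parameter with the site. -/
theorem siteMinus_mul_lax (hko : k ≠ o) {l u up um : ℂ} (vp : ℂ) {vm : ℂ}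
    (hl : ∀ j : ℕ, 2 * l ≠ -(j : ℂ)) (ha : u + l = up - vm) (hb : 2 * l = up - um) :
    Matrix.scalar (Fin 2) (siteMinus l u k o) * (lax k up um * lax o vp vm) =
      lax o up vm * lax k vp um * Matrix.scalar (Fin 2) (siteMinus l u k o) := by
  rw [siteMinus, map_mul, mul_assoc, scalar_rMinus_mul_lax hko vp hl ha hb, ← mul_assoc,
    ← mul_assoc, permOp_mul_lax_left, mul_assoc (lax o up vm), permOp_mul_lax_right]
  simp only [mul_assoc]

/-- Here the auxiliary matrix keeps its plus parameter and trades its minus parameter. -/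
theorem lax_mul_sitePlus (hko : k ≠ o) {l u up vp vm : ℂ} (um : ℂ)
    (hl : ∀ j : ℕ, 1 + l - u ≠ -(j : ℂ)) (ha : 2 * l = vp - vm) (hb : 1 + l - u = up - vm) :
    lax o up um * lax k vp vm * Matrix.scalar (Fin 2) (sitePlus l u k o) =
      Matrix.scalar (Fin 2) (sitePlus l u k o) * (lax k vp um * lax o up vm) := by
  rw [sitePlus, map_mul, mul_assoc (Matrix.scalar (Fin 2) (permOp k o)),
    ← lax_mul_scalar_rPlus hko um hl ha hb, ← mul_assoc, ← mul_assoc, ← mul_assoc,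
    permOp_mul_lax_left, mul_assoc (lax o up um) _ (lax o vp vm), permOp_mul_lax_right]
  simp only [mul_assoc]

variable {k' : σ}

theorem permOp_lax_of_ne (h : k' ≠ k) (h' : k' ≠ o) (up um : ℂ) :
    Matrix.scalar (Fin 2) (permOp k o) * lax k' up um =
      lax k' up um * Matrix.scalar (Fin 2) (permOp k o) :=
  scalar_mul_lax_of_intertwine (by simp [permOp_mulZ, Equiv.swap_apply_of_ne_of_ne h h'])
    (by simp [permOp_diffZ, Equiv.swap_apply_of_ne_of_ne h h']) up um

theorem relEulerFun_lax_of_ne (f : ℕ → ℂ) (hko : k ≠ o) (h : k' ≠ k) (h' : k' ≠ o) (up um : ℂ) :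
    Matrix.scalar (Fin 2) (relEulerFun f k o) * lax k' up um =
      lax k' up um * Matrix.scalar (Fin 2) (relEulerFun f k o) :=
  scalar_mul_lax_of_intertwine (relEulerFun_mulZ_of_ne f h) (relEulerFun_diffZ_of_ne f hko h h')
    up um

theorem siteMinus_lax_of_ne (l u : ℂ) (hko : k ≠ o) (h : k' ≠ k) (h' : k' ≠ o) (up um : ℂ) :
    Commute (Matrix.scalar (Fin 2) (siteMinus l u k o)) (lax k' up um) := by
  rw [siteMinus, map_mul]
  exact Commute.mul_left (permOp_lax_of_ne h h' up um) (relEulerFun_lax_of_ne _ hko h h' up um)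

theorem sitePlus_lax_of_ne (l u : ℂ) (hko : k ≠ o) (h : k' ≠ k) (h' : k' ≠ o) (up um : ℂ) :
    Commute (Matrix.scalar (Fin 2) (sitePlus l u k o)) (lax k' up um) := by
  rw [sitePlus, map_mul]
  exact Commute.mul_left (permOp_lax_of_ne h h' up um)
    (relEulerFun_lax_of_ne _ hko.symm h' h up um)

end LocalRelations

/-! ### Transport of the auxiliary Lax matrix through the whole chain. -/

section Chains

variable {σ : Type}

theorem commute_ofFn_prod {M : Type} [Monoid M] {m : ℕ} {x : M} {f : Fin m → M}
    (h : ∀ i, Commute x (f i)) : Commute x (List.ofFn f).prod := by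
  refine Commute.list_prod_right _ _ fun y hy => ?_
  obtain ⟨i, rfl⟩ := (List.mem_ofFn' _ _).1 hy
  exact h i

theorem scalar_ofFn_prod {m : ℕ} (f : Fin m → Module.End ℂ (MvPolynomial σ ℂ)) :
    Matrix.scalar (Fin 2) (List.ofFn f).prod =
      (List.ofFn fun i => Matrix.scalar (Fin 2) (f i)).prod := by
  rw [map_list_prod, List.map_ofFn]; rfl

variable [DecidableEq σ] {o : σ}

/-- The auxiliary matrix enters on the right with plus parameter `up (Fin.last m)`, gives it to the
last site, takes that site's own, and so on; each site ends with the plus parameter of its right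
neighbour. The length of `up` is `m + 1` so that no cyclic condition is needed in the induction. -/
theorem chain_minus (m : ℕ) (s : Fin m → σ) (hs : Function.Injective s) (hso : ∀ k, s k ≠ o)
    (l w um : Fin m → ℂ) (up : Fin (m + 1) → ℂ) (v : ℂ)
    (hl : ∀ (k : Fin m) (j : ℕ), 2 * l k ≠ -(j : ℂ))
    (ha : ∀ k, w k + l k = up k.castSucc - v) (hb : ∀ k, 2 * l k = up k.castSucc - um k) :
    Matrix.scalar (Fin 2) (List.ofFn fun k => siteMinus (l k) (w k) (s k) o).prod *
        ((List.ofFn fun k => lax (s k) (up k.castSucc) (um k)).prod * lax o (up (Fin.last m)) v) =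
      lax o (up 0) v * ((List.ofFn fun k => lax (s k) (up k.succ) (um k)).prod *
        Matrix.scalar (Fin 2) (List.ofFn fun k => siteMinus (l k) (w k) (s k) o).prod) := by
  induction m with
  | zero => simp
  | succ m ih =>
    have ih' := ih (fun k => s k.succ) (fun a b h => Fin.succ_injective _ (hs h))
      (fun k => hso _) (fun k => l k.succ) (fun k => w k.succ) (fun k => um k.succ)
      (fun k => up k.succ) (fun k => hl _) (fun k => ha _) (fun k => hb _)
    have hne : ∀ k : Fin m, s k.succ ≠ s 0 := fun k h => Fin.succ_ne_zero k (hs h)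
    simp only [List.ofFn_succ, List.prod_cons, map_mul]
    have c1 : Commute (Matrix.scalar (Fin 2)
        (List.ofFn fun k : Fin m => siteMinus (l k.succ) (w k.succ) (s k.succ) o).prod)
        (lax (s 0) (up (Fin.castSucc 0)) (um 0)) := by
      rw [scalar_ofFn_prod]
      exact (commute_ofFn_prod fun k =>
        (siteMinus_lax_of_ne _ _ (hso _) (hne k).symm (hso 0) _ _).symm).symm
    have c2 : Commute (Matrix.scalar (Fin 2) (siteMinus (l 0) (w 0) (s 0) o))
        (List.ofFn fun k : Fin m => lax (s k.succ) (up k.succ.succ) (um k.succ)).prod :=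
      commute_ofFn_prod fun k => siteMinus_lax_of_ne _ _ (hso 0) (hne k) (hso _) _ _
    have hloc := siteMinus_mul_lax (hso 0) (up (Fin.succ 0)) (hl 0) (ha 0) (hb 0)
    simp only [Fin.succ_last, Fin.castSucc_zero, ← Fin.succ_castSucc] at ih' hloc c1 c2 ⊢
    rw [mul_assoc, mul_assoc, ← mul_assoc _ (lax (s 0) (up 0) (um 0)), c1.eq, mul_assoc, ih',
      ← mul_assoc (lax (s 0) _ _), ← mul_assoc (Matrix.scalar (Fin 2) _), hloc]
    simp only [mul_assoc]
    rw [← mul_assoc (Matrix.scalar (Fin 2) (siteMinus (l 0) (w 0) (s 0) o)), c2.eq]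
    simp only [mul_assoc]

theorem chain_plus (m : ℕ) (s : Fin m → σ) (hs : Function.Injective s) (hso : ∀ k, s k ≠ o)
    (l w up : Fin m → ℂ) (um : Fin (m + 1) → ℂ) (v : ℂ)
    (hl : ∀ (k : Fin m) (j : ℕ), 1 + l k - w k ≠ -(j : ℂ))
    (ha : ∀ k, 2 * l k = up k - um k.succ) (hb : ∀ k, 1 + l k - w k = v - um k.succ) :
    lax o v (um 0) * ((List.ofFn fun k => lax (s k) (up k) (um k.succ)).prod *
        Matrix.scalar (Fin 2) (List.ofFn fun k => sitePlus (l k) (w k) (s k) o).prod) =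
      Matrix.scalar (Fin 2) (List.ofFn fun k => sitePlus (l k) (w k) (s k) o).prod *
        ((List.ofFn fun k => lax (s k) (up k) (um k.castSucc)).prod *
          lax o v (um (Fin.last m))) := by
  induction m with
  | zero => simp
  | succ m ih =>
    have ih' := ih (fun k => s k.succ) (fun a b h => Fin.succ_injective _ (hs h))
      (fun k => hso _) (fun k => l k.succ) (fun k => w k.succ) (fun k => up k.succ)
      (fun k => um k.succ) (fun k => hl _) (fun k => ha _) (fun k => hb _)
    have hne : ∀ k : Fin m, s k.succ ≠ s 0 := fun k h => Fin.succ_ne_zero k (hs h)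
    simp only [List.ofFn_succ, List.prod_cons, map_mul]
    have c1 : Commute (Matrix.scalar (Fin 2)
        (List.ofFn fun k : Fin m => sitePlus (l k.succ) (w k.succ) (s k.succ) o).prod)
        (lax (s 0) (up 0) (um (Fin.castSucc 0))) := by
      rw [scalar_ofFn_prod]
      exact (commute_ofFn_prod fun k =>
        (sitePlus_lax_of_ne _ _ (hso _) (hne k).symm (hso 0) _ _).symm).symm
    have c2 : Commute (Matrix.scalar (Fin 2) (sitePlus (l 0) (w 0) (s 0) o))
        (List.ofFn fun k : Fin m => lax (s k.succ) (up k.succ) (um k.succ.succ)).prod :=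
      commute_ofFn_prod fun k => sitePlus_lax_of_ne _ _ (hso 0) (hne k) (hso _) _ _
    have hloc := lax_mul_sitePlus (hso 0) (um 0) (hl 0) (ha 0) (hb 0)
    simp only [Fin.succ_last, Fin.castSucc_zero, ← Fin.succ_castSucc] at ih' hloc c1 c2 ⊢
    rw [mul_assoc (lax (s 0) _ _), ← mul_assoc _ (Matrix.scalar (Fin 2) (sitePlus (l 0) _ _ _)),
      ← c2.eq, mul_assoc (Matrix.scalar (Fin 2) (sitePlus (l 0) _ _ _)), ← mul_assoc, ← mul_assoc,
      hloc, mul_assoc, mul_assoc, ih', ← mul_assoc (lax (s 0) _ _), ← c1.eq]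
    simp only [mul_assoc]

end Chains

end SpinChain

namespace SpinChain

open MvPolynomial Filter Topology

/-! ### Matrix elements with respect to the powers of `z_0`. -/

section AuxiliarySpace

variable {n : ℕ}

/-- The map `Ψ ↦ z_0^m Ψ`. -/
def auxIn (m : ℕ) : MvPolynomial (Fin n) ℂ →ₗ[ℂ] MvPolynomial (Fin (n + 1)) ℂ :=
  LinearMap.mulLeft ℂ (X 0 ^ m) ∘ₗ renameOp Fin.succ

/-- The coefficient of `z_0^m`. -/
def auxOut (m : ℕ) : MvPolynomial (Fin (n + 1)) ℂ →ₗ[ℂ] MvPolynomial (Fin n) ℂ where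
  toFun p := (finSuccEquiv ℂ n p).coeff m
  map_add' p q := by simp
  map_smul' c p := by
    rw [map_smul]; simp [Polynomial.coeff_smul]

/-- The matrix element of `A` between `z_0^j` and `z_0^i`. -/
def matEl (A : Module.End ℂ (MvPolynomial (Fin (n + 1)) ℂ)) (i j : ℕ) :
    Module.End ℂ (MvPolynomial (Fin n) ℂ) :=
  auxOut i ∘ₗ A ∘ₗ auxIn j

theorem auxTerm_eq (A : Module.End ℂ (MvPolynomial (Fin (n + 1)) ℂ)) (m : ℕ)
    (Ψ : MvPolynomial (Fin n) ℂ) : auxTerm A m Ψ = matEl A m m Ψ := rfl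

theorem coeff_auxOut (m : ℕ) (p : MvPolynomial (Fin (n + 1)) ℂ) (d : Fin n →₀ ℕ) :
    (auxOut m p).coeff d = p.coeff (d.cons m) :=
  finSuccEquiv_coeff_coeff d p m

theorem ext_auxOut {p q : MvPolynomial (Fin (n + 1)) ℂ} (h : ∀ m, auxOut m p = auxOut m q) :
    p = q :=
  (finSuccEquiv ℂ n).injective (Polynomial.ext h)

theorem auxOut_mulZ_zero (p : MvPolynomial (Fin (n + 1)) ℂ) : auxOut 0 (mulZ 0 p) = 0 := by
  simp [auxOut, finSuccEquiv_X_zero]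

theorem auxOut_mulZ_succ (m : ℕ) (p : MvPolynomial (Fin (n + 1)) ℂ) :
    auxOut (m + 1) (mulZ 0 p) = auxOut m p := by
  simp [auxOut, finSuccEquiv_X_zero]

theorem auxOut_diffZ (m : ℕ) (p : MvPolynomial (Fin (n + 1)) ℂ) :
    auxOut m (diffZ 0 p) = ((m : ℂ) + 1) • auxOut (m + 1) p := by
  ext d
  rw [coeff_auxOut, diffZ_apply, coeff_pderiv, coeff_smul, coeff_auxOut, smul_eq_mul, mul_comm]
  congr 2
  ext i
  refine Fin.cases ?_ (fun i => ?_) i <;> simp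

theorem auxOut_mulZ_site (k : Fin n) (m : ℕ) (p : MvPolynomial (Fin (n + 1)) ℂ) :
    auxOut m (mulZ k.succ p) = mulZ k (auxOut m p) := by
  simp [auxOut, finSuccEquiv_X_succ]

theorem auxOut_diffZ_site (k : Fin n) (m : ℕ) (p : MvPolynomial (Fin (n + 1)) ℂ) :
    auxOut m (diffZ k.succ p) = diffZ k (auxOut m p) := by
  ext d
  rw [coeff_auxOut, diffZ_apply, diffZ_apply, coeff_pderiv, coeff_pderiv, coeff_auxOut]
  congr 2
  ext i
  refine Fin.cases ?_ (fun i => ?_) i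
  · simp
  · simp [Finsupp.single_apply, Fin.succ_inj]

theorem mulZ_auxIn (m : ℕ) (Ψ : MvPolynomial (Fin n) ℂ) :
    mulZ 0 (auxIn m Ψ) = auxIn (m + 1) Ψ := by
  simp [auxIn, pow_succ']

theorem diffZ_auxIn (m : ℕ) (Ψ : MvPolynomial (Fin n) ℂ) :
    diffZ 0 (auxIn m Ψ) = (m : ℂ) • auxIn (m - 1) Ψ := by
  have h : pderiv 0 (rename Fin.succ Ψ : MvPolynomial (Fin (n + 1)) ℂ) = 0 := by
    refine pderiv_eq_zero_of_notMem_vars fun h => ?_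
    obtain ⟨k, -, hk⟩ := Finset.mem_image.1 (vars_rename _ _ h)
    exact Fin.succ_ne_zero k hk
  simp [auxIn, renameOp, Derivation.leibniz, h, Derivation.leibniz_pow, Algebra.smul_def]
  ring

theorem auxOut_auxIn (i j : ℕ) (Ψ : MvPolynomial (Fin n) ℂ) :
    auxOut i (auxIn j Ψ) = if i = j then Ψ else 0 := by
  have h : finSuccEquiv ℂ n (rename Fin.succ Ψ) = Polynomial.C Ψ := by
    induction Ψ using MvPolynomial.induction_on with
    | C a => simp [finSuccEquiv_apply]
    | add p q hp hq => simp [hp, hq]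
    | mul_X p k hp => simp [hp, finSuccEquiv_X_succ]
  simp only [auxOut, auxIn, renameOp]
  simp [finSuccEquiv_X_zero, h]

theorem matEl_mul_mulZ (A : Module.End ℂ (MvPolynomial (Fin (n + 1)) ℂ)) (i j : ℕ) :
    matEl (A * mulZ 0) i j = matEl A i (j + 1) :=
  LinearMap.ext fun Ψ => by
    simp only [matEl, LinearMap.comp_apply, Module.End.mul_apply, mulZ_auxIn]

theorem matEl_mulZ_mul_zero (A : Module.End ℂ (MvPolynomial (Fin (n + 1)) ℂ)) (j : ℕ) :
    matEl (mulZ 0 * A) 0 j = 0 :=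
  LinearMap.ext fun Ψ => by
    simp only [matEl, LinearMap.comp_apply, Module.End.mul_apply, auxOut_mulZ_zero,
      LinearMap.zero_apply]

theorem matEl_mulZ_mul_succ (A : Module.End ℂ (MvPolynomial (Fin (n + 1)) ℂ)) (i j : ℕ) :
    matEl (mulZ 0 * A) (i + 1) j = matEl A i j :=
  LinearMap.ext fun Ψ => by
    simp only [matEl, LinearMap.comp_apply, Module.End.mul_apply, auxOut_mulZ_succ]

theorem matEl_mul_diffZ (A : Module.End ℂ (MvPolynomial (Fin (n + 1)) ℂ)) (i j : ℕ) :
    matEl (A * diffZ 0) i j = (j : ℂ) • matEl A i (j - 1) :=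
  LinearMap.ext fun Ψ => by
    simp only [matEl, LinearMap.comp_apply, Module.End.mul_apply, diffZ_auxIn, map_smul,
      LinearMap.smul_apply]

theorem matEl_diffZ_mul (A : Module.End ℂ (MvPolynomial (Fin (n + 1)) ℂ)) (i j : ℕ) :
    matEl (diffZ 0 * A) i j = ((i : ℂ) + 1) • matEl A (i + 1) j :=
  LinearMap.ext fun Ψ => by
    simp only [matEl, LinearMap.comp_apply, Module.End.mul_apply, auxOut_diffZ,
      LinearMap.smul_apply]

theorem matEl_add (A B : Module.End ℂ (MvPolynomial (Fin (n + 1)) ℂ)) (i j : ℕ) :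
    matEl (A + B) i j = matEl A i j + matEl B i j :=
  LinearMap.ext fun Ψ => by simp [matEl]

theorem matEl_sub (A B : Module.End ℂ (MvPolynomial (Fin (n + 1)) ℂ)) (i j : ℕ) :
    matEl (A - B) i j = matEl A i j - matEl B i j :=
  LinearMap.ext fun Ψ => by simp [matEl]

theorem matEl_smul (c : ℂ) (A : Module.End ℂ (MvPolynomial (Fin (n + 1)) ℂ)) (i j : ℕ) :
    matEl (c • A) i j = c • matEl A i j :=
  LinearMap.ext fun Ψ => by simp [matEl]

/-- The sum telescopes because multiplication by `z_0` only shifts the index of the matrix elements;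
one boundary term survives. -/
theorem sum_matEl_commutator_mulZ (W : Module.End ℂ (MvPolynomial (Fin (n + 1)) ℂ)) (N : ℕ) :
    ∑ m ∈ Finset.range (N + 1), matEl (W * mulZ 0 - mulZ 0 * W) m m = matEl W N (N + 1) := by
  induction N with
  | zero => simp [matEl_sub, matEl_mul_mulZ, matEl_mulZ_mul_zero]
  | succ N ih =>
    rw [Finset.sum_range_succ, ih, matEl_sub, matEl_mul_mulZ, matEl_mulZ_mul_succ]
    abel

/-- The boundary term now carries the weight `N + 1` from differentiating `z_0 ^ (N + 1)`. This is
why decay faster than `1 / N` is demanded in `DiagDecay`. -/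
theorem sum_matEl_commutator_diffZ (W : Module.End ℂ (MvPolynomial (Fin (n + 1)) ℂ)) (N : ℕ) :
    ∑ m ∈ Finset.range (N + 1), matEl (W * diffZ 0 - diffZ 0 * W) m m =
      -(((N : ℂ) + 1) • matEl W (N + 1) N) := by
  induction N with
  | zero => simp [matEl_sub, matEl_mul_diffZ, matEl_diffZ_mul]
  | succ N ih =>
    rw [Finset.sum_range_succ, ih, matEl_sub, matEl_mul_diffZ, matEl_diffZ_mul]
    push_cast
    abel

/-- `A'` acts on the variables `z_1, …, z_n` of `ℂ[z_0, …, z_n]` as `A` does. -/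
def IsLift (A' : Module.End ℂ (MvPolynomial (Fin (n + 1)) ℂ))
    (A : Module.End ℂ (MvPolynomial (Fin n) ℂ)) : Prop :=
  ∀ m p, auxOut m (A' p) = A (auxOut m p)

namespace IsLift

variable {A' B' : Module.End ℂ (MvPolynomial (Fin (n + 1)) ℂ)}
  {A B : Module.End ℂ (MvPolynomial (Fin n) ℂ)}

theorem apply_auxIn (h : IsLift A' A) (m : ℕ) (Ψ : MvPolynomial (Fin n) ℂ) :
    A' (auxIn m Ψ) = auxIn m (A Ψ) :=
  ext_auxOut fun i => by
    rw [h, auxOut_auxIn, auxOut_auxIn]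
    split_ifs <;> simp

theorem zero : IsLift (0 : Module.End ℂ (MvPolynomial (Fin (n + 1)) ℂ)) 0 := fun m p => by simp

theorem one : IsLift (1 : Module.End ℂ (MvPolynomial (Fin (n + 1)) ℂ)) 1 := fun m p => by simp

theorem add (hA : IsLift A' A) (hB : IsLift B' B) : IsLift (A' + B') (A + B) := fun m p => by
  simp [hA m p, hB m p]

theorem neg (hA : IsLift A' A) : IsLift (-A') (-A) := fun m p => by simp [hA m p]

theorem sub (hA : IsLift A' A) (hB : IsLift B' B) : IsLift (A' - B') (A - B) := fun m p => by
  simp [hA m p, hB m p]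

theorem smul (c : ℂ) (hA : IsLift A' A) : IsLift (c • A') (c • A) := fun m p => by simp [hA m p]

theorem mul (hA : IsLift A' A) (hB : IsLift B' B) : IsLift (A' * B') (A * B) := fun m p => by
  simp [hA m _, hB m p]

theorem matEl_mul (hA : IsLift A' A) (B' : Module.End ℂ (MvPolynomial (Fin (n + 1)) ℂ))
    (i j : ℕ) : matEl (A' * B') i j = A * matEl B' i j :=
  LinearMap.ext fun _ => hA _ _

theorem mul_matEl (hA : IsLift A' A) (B' : Module.End ℂ (MvPolynomial (Fin (n + 1)) ℂ))
    (i j : ℕ) : matEl (B' * A') i j = matEl B' i j * A :=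
  LinearMap.ext fun Ψ => by
    simp only [matEl, LinearMap.comp_apply, Module.End.mul_apply, hA.apply_auxIn]

end IsLift

theorem isLift_mulZ (k : Fin n) : IsLift (mulZ k.succ) (mulZ k) := auxOut_mulZ_site k

theorem isLift_diffZ (k : Fin n) : IsLift (diffZ k.succ) (diffZ k) := auxOut_diffZ_site k

theorem isLift_lax (k : Fin n) (up um : ℂ) (a b : Fin 2) :
    IsLift (lax k.succ up um a b) (lax k up um a b) := by
  have hz := isLift_mulZ k
  have hd := isLift_diffZ k
  fin_cases a <;> fin_cases b
  · exact (IsLift.one.smul _).add (hz.mul hd)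
  · exact hd.neg
  · simp only [lax, pow_two]
    exact ((hz.mul hz).mul hd).add (hz.smul _)
  · exact (IsLift.one.smul _).sub (hz.mul hd)

theorem isLift_lax_prod {m : ℕ} (s : Fin m → Fin n) (up um : Fin m → ℂ) (a b : Fin 2) :
    IsLift ((List.ofFn fun k => lax (s k).succ (up k) (um k)).prod a b)
      ((List.ofFn fun k => lax (s k) (up k) (um k)).prod a b) := by
  induction m generalizing a b with
  | zero =>
    by_cases h : a = b
    · subst h; simpa using IsLift.one
    · simpa [h] using IsLift.zero
  | succ m ih =>
    simp only [List.ofFn_succ, List.prod_cons, Matrix.mul_apply, Fin.sum_univ_two]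
    exact ((isLift_lax _ _ _ _ _).mul (ih _ _ _ _ _)).add
      ((isLift_lax _ _ _ _ _).mul (ih _ _ _ _ _))

end AuxiliarySpace

/-! ### Coefficientwise limits of polynomials. -/

section CoefficientwiseLimits

variable {σ : Type}

/-- Coefficientwise convergence of a sequence of polynomials. -/
def CoeffTendsto (F : ℕ → MvPolynomial σ ℂ) (Φ : MvPolynomial σ ℂ) : Prop :=
  ∀ d, Tendsto (fun N => (F N).coeff d) atTop (𝓝 (Φ.coeff d))

/-- Operators that preserve coefficientwise convergence. -/
def CoeffContinuous (A : Module.End ℂ (MvPolynomial σ ℂ)) : Prop :=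
  ∀ ⦃F Φ⦄, CoeffTendsto F Φ → CoeffTendsto (fun N => A (F N)) (A Φ)

namespace CoeffTendsto

variable {F G : ℕ → MvPolynomial σ ℂ} {Φ Γ : MvPolynomial σ ℂ}

theorem unique (h : CoeffTendsto F Φ) (h' : CoeffTendsto F Γ) : Φ = Γ :=
  MvPolynomial.ext _ _ fun d => tendsto_nhds_unique (h d) (h' d)

theorem add (h : CoeffTendsto F Φ) (h' : CoeffTendsto G Γ) :
    CoeffTendsto (fun N => F N + G N) (Φ + Γ) := fun d => by
  simpa using (h d).add (h' d)

theorem sub (h : CoeffTendsto F Φ) (h' : CoeffTendsto G Γ) :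
    CoeffTendsto (fun N => F N - G N) (Φ - Γ) := fun d => by
  simpa using (h d).sub (h' d)

theorem neg (h : CoeffTendsto F Φ) : CoeffTendsto (fun N => -F N) (-Φ) := fun d => by
  simpa using (h d).neg

theorem smul (c : ℂ) (h : CoeffTendsto F Φ) : CoeffTendsto (fun N => c • F N) (c • Φ) := fun d => by
  simpa using (h d).const_mul c

theorem of_smul (h : CoeffTendsto (fun N => ((N : ℂ) + 1) • F N) 0) : CoeffTendsto F 0 := by
  intro d
  have h1 : Tendsto (fun N : ℕ => ((N : ℂ) + 1)⁻¹) atTop (𝓝 0) := by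
    simpa using tendsto_one_div_add_atTop_nhds_zero_nat (𝕜 := ℂ)
  have h2 := h1.mul (h d)
  refine (h2.congr fun N => ?_).trans (by simp)
  have : (N : ℂ) + 1 ≠ 0 := Nat.cast_add_one_ne_zero N
  simp [this]

end CoeffTendsto

namespace CoeffContinuous

variable {A B : Module.End ℂ (MvPolynomial σ ℂ)}

theorem zero : CoeffContinuous (0 : Module.End ℂ (MvPolynomial σ ℂ)) := fun _ _ _ _ => by simp

theorem one : CoeffContinuous (1 : Module.End ℂ (MvPolynomial σ ℂ)) := fun _ _ h => h

theorem add (hA : CoeffContinuous A) (hB : CoeffContinuous B) : CoeffContinuous (A + B) :=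
  fun _ _ h => (hA h).add (hB h)

theorem sub (hA : CoeffContinuous A) (hB : CoeffContinuous B) : CoeffContinuous (A - B) :=
  fun _ _ h => (hA h).sub (hB h)

theorem neg (hA : CoeffContinuous A) : CoeffContinuous (-A) := fun _ _ h => (hA h).neg

theorem smul (c : ℂ) (hA : CoeffContinuous A) : CoeffContinuous (c • A) :=
  fun _ _ h => (hA h).smul c

theorem mul (hA : CoeffContinuous A) (hB : CoeffContinuous B) : CoeffContinuous (A * B) :=
  fun _ _ h => hA (hB h)

end CoeffContinuous

/-- A coefficient of the image depends on at most one coefficient of the argument, so limits pass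
through. The transfer matrix has to be moved inside a trace that converges only coefficientwise. -/
theorem coeffContinuous_mulZ (i : σ) : CoeffContinuous (mulZ i) := by
  classical
  intro F Φ h d
  simp only [mulZ_apply, coeff_X_mul']
  split_ifs
  · exact h _
  · exact tendsto_const_nhds

theorem coeffContinuous_diffZ (i : σ) : CoeffContinuous (diffZ i) := by
  intro F Φ h d
  simp only [diffZ_apply, coeff_pderiv]
  exact (h _).mul_const _

theorem coeffContinuous_lax (i : σ) (up um : ℂ) (a b : Fin 2) :
    CoeffContinuous (lax i up um a b) := by
  have hz := coeffContinuous_mulZ i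
  have hd := coeffContinuous_diffZ i
  fin_cases a <;> fin_cases b
  · exact (CoeffContinuous.one.smul _).add (hz.mul hd)
  · exact hd.neg
  · simp only [lax, pow_two]
    exact ((hz.mul hz).mul hd).add (hz.smul _)
  · exact (CoeffContinuous.one.smul _).sub (hz.mul hd)

theorem coeffContinuous_lax_prod {m : ℕ} (s : Fin m → σ) (up um : Fin m → ℂ) (a b : Fin 2) :
    CoeffContinuous ((List.ofFn fun k => lax (s k) (up k) (um k)).prod a b) := by
  induction m generalizing a b with
  | zero =>
    by_cases h : a = b
    · subst h; simpa using CoeffContinuous.one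
    · simpa [h] using CoeffContinuous.zero
  | succ m ih =>
    simp only [List.ofFn_succ, List.prod_cons, Matrix.mul_apply, Fin.sum_univ_two]
    exact ((coeffContinuous_lax _ _ _ _ _).mul (ih _ _ _ _ _)).add
      ((coeffContinuous_lax _ _ _ _ _).mul (ih _ _ _ _ _))

end CoefficientwiseLimits

/-! ### Cancelling the auxiliary Lax matrix under the trace. -/

section TraceCyclicity

variable {n : ℕ}

/-- The matrix elements of `A` near the diagonal decay faster than `1 / N`. -/
def DiagDecay (A : Module.End ℂ (MvPolynomial (Fin (n + 1)) ℂ)) : Prop :=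
  ∀ (i j : ℕ) (Ψ : MvPolynomial (Fin n) ℂ),
    CoeffTendsto (fun N => ((N : ℂ) + 1) • matEl A (N + i) (N + j) Ψ) 0

theorem DiagDecay.lift_mul {A A' B : _} (hB : DiagDecay (n := n) B) (hA : IsLift A' A)
    (hA' : CoeffContinuous A) : DiagDecay (A' * B) := fun i j Ψ => by
  have := hA' (hB i j Ψ)
  simpa [hA.matEl_mul] using this

theorem DiagDecay.mul_lift {A A' B : _} (hB : DiagDecay (n := n) B) (hA : IsLift A' A) :
    DiagDecay (B * A') := fun i j Ψ => by
  have := hB i j (A Ψ)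
  simpa [hA.mul_matEl] using this

/-- By `trace_sub_trace_of_intertwine` the partial trace is reduced to the two boundary terms of the
telescoping sums, and these vanish in the limit by the decay hypotheses. -/
theorem partialTrace_sub_tendsto_zero {up um : ℂ} (hup : up - 1 ≠ 0) (hum : um ≠ 0)
    {S T : Matrix (Fin 2) (Fin 2) (Module.End ℂ (MvPolynomial (Fin (n + 1)) ℂ))}
    (hST : S * lax 0 up um = lax 0 up um * T)
    (hS : ∀ a b, DiagDecay (S a b)) (hT : ∀ a b, DiagDecay (T a b)) (Ψ : MvPolynomial (Fin n) ℂ) :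
    CoeffTendsto (fun N => ∑ m ∈ Finset.range (N + 1), matEl (S.trace - T.trace) m m Ψ) 0 := by
  have h := trace_sub_trace_of_intertwine (diffZ_mulZ_self 0) up hum hST
  rw [lowerTri_conj_one_zero] at h
  obtain ⟨B, hB⟩ : ∃ B, B = T 1 0 + T 1 1 * mulZ 0 - mulZ 0 * (T 0 0 + T 0 1 * mulZ 0) := ⟨_, rfl⟩
  rw [← hB] at h
  have hsum : ∀ N, ∑ m ∈ Finset.range (N + 1), matEl (S.trace - T.trace) m m Ψ =
      matEl (T 0 1 - S 0 1) N (N + 1) Ψ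
        - (up - 1)⁻¹ • (((N : ℂ) + 1) • matEl B (N + 1) N Ψ) := by
    intro N
    have h1 : (up - 1) • ∑ m ∈ Finset.range (N + 1), matEl (S.trace - T.trace) m m =
        (up - 1) • matEl (T 0 1 - S 0 1) N (N + 1) - ((N : ℂ) + 1) • matEl B (N + 1) N := by
      rw [← sum_matEl_commutator_mulZ, sub_eq_add_neg (_ • _), ← sum_matEl_commutator_diffZ,
        Finset.smul_sum, Finset.smul_sum, ← Finset.sum_add_distrib]
      refine Finset.sum_congr rfl fun m _ => ?_
      rw [← matEl_smul, ← matEl_smul, ← matEl_add, h]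
    have h2 := congrArg (fun A => (up - 1)⁻¹ • A Ψ) h1
    simpa [smul_sub, smul_smul, inv_mul_cancel₀ hup] using h2
  -- The factors `mulZ 0` in `B` are absorbed into index shifts, so only entries of `T` near the
  -- diagonal occur.
  have hBN : ∀ N, matEl B (N + 1) N =
      matEl (T 1 0) (N + 1) N + matEl (T 1 1) (N + 1) (N + 1)
        - (matEl (T 0 0) N N + matEl (T 0 1) N (N + 1)) := by
    intro N
    rw [hB, matEl_sub, matEl_add, matEl_mul_mulZ, matEl_mulZ_mul_succ, matEl_add, matEl_mul_mulZ]
  simp only [hsum, hBN, matEl_sub (T 0 1)]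
  have e1 := ((hT 0 1 0 1 Ψ).of_smul).sub ((hS 0 1 0 1 Ψ).of_smul)
  have e2 := (((hT 1 0 1 0 Ψ).add (hT 1 1 1 1 Ψ)).sub
    ((hT 0 0 0 0 Ψ).add (hT 0 1 0 1 Ψ))).smul (up - 1)⁻¹
  have e3 := e1.sub e2
  simpa only [add_zero, sub_zero, smul_zero, LinearMap.sub_apply, LinearMap.add_apply, smul_add,
    smul_sub] using e3

theorem HasAuxTrace.coeffTendsto {A : Module.End ℂ (MvPolynomial (Fin (n + 1)) ℂ)}
    {B : Module.End ℂ (MvPolynomial (Fin n) ℂ)} (h : HasAuxTrace A B)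
    (Ψ : MvPolynomial (Fin n) ℂ) :
    CoeffTendsto (fun N => ∑ m ∈ Finset.range (N + 1), matEl A m m Ψ) (B Ψ) := fun d => by
  have := ((h Ψ d).tendsto_sum_nat).comp (tendsto_add_atTop_nat 1)
  refine this.congr fun N => ?_
  simp [auxTerm_eq, coeff_sum]

/-- The trace over `V_0` of an operator and of a transfer matrix, in the form of an intertwining
relation: the auxiliary Lax matrix may be cancelled under the trace. -/
theorem HasAuxTrace.intertwine_left {A : Module.End ℂ (MvPolynomial (Fin (n + 1)) ℂ)}
    {Q : Module.End ℂ (MvPolynomial (Fin n) ℂ)} (h : HasAuxTrace A Q) (hA : DiagDecay A)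
    {up um : ℂ} (hup : up - 1 ≠ 0) (hum : um ≠ 0)
    {S' T' : Matrix (Fin 2) (Fin 2) (Module.End ℂ (MvPolynomial (Fin (n + 1)) ℂ))}
    {S T : Matrix (Fin 2) (Fin 2) (Module.End ℂ (MvPolynomial (Fin n) ℂ))}
    (hS : ∀ a b, IsLift (S' a b) (S a b)) (hT : ∀ a b, IsLift (T' a b) (T a b))
    (hTc : ∀ a b, CoeffContinuous (T a b))
    (hrel : Matrix.scalar (Fin 2) A * S' * lax 0 up um =
      lax 0 up um * (T' * Matrix.scalar (Fin 2) A)) :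
    Q * S.trace = T.trace * Q := by
  have hl : ∀ a b, (Matrix.scalar (Fin 2) A * S') a b = A * S' a b := fun a b => by
    rw [S'.eta_fin_two, scalar_mul_fin_two]; fin_cases a <;> fin_cases b <;> rfl
  have hr : ∀ a b, (T' * Matrix.scalar (Fin 2) A) a b = T' a b * A := fun a b => by
    rw [T'.eta_fin_two, fin_two_mul_scalar]; fin_cases a <;> fin_cases b <;> rfl
  refine LinearMap.ext fun Ψ => ?_
  have key := partialTrace_sub_tendsto_zero hup hum hrel
    (fun a b => by rw [hl]; exact hA.mul_lift (hS a b))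
    (fun a b => by rw [hr]; exact hA.lift_mul (hT a b) (hTc a b)) Ψ
  have hS' : IsLift S'.trace S.trace := by
    rw [Matrix.trace_fin_two, Matrix.trace_fin_two]; exact (hS _ _).add (hS _ _)
  have hT' : IsLift T'.trace T.trace := by
    rw [Matrix.trace_fin_two, Matrix.trace_fin_two]; exact (hT _ _).add (hT _ _)
  have hTc' : CoeffContinuous T.trace := by
    rw [Matrix.trace_fin_two]; exact (hTc _ _).add (hTc _ _)
  have tl : (Matrix.scalar (Fin 2) A * S').trace = A * S'.trace := by
    rw [Matrix.trace_fin_two, Matrix.trace_fin_two, hl, hl, mul_add]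
  have tr : (T' * Matrix.scalar (Fin 2) A).trace = T'.trace * A := by
    rw [Matrix.trace_fin_two, Matrix.trace_fin_two, hr, hr, add_mul]
  have lim := (h.coeffTendsto (S.trace Ψ)).sub (hTc' (h.coeffTendsto Ψ))
  simp only [tl, tr, matEl_sub, hS'.mul_matEl, hT'.matEl_mul] at key
  have : CoeffTendsto (fun N => ∑ m ∈ Finset.range (N + 1),
      (matEl A m m * S.trace - T.trace * matEl A m m) Ψ) (Q (S.trace Ψ) - T.trace (Q Ψ)) := by
    simpa [Finset.sum_sub_distrib] using lim
  exact sub_eq_zero.1 (this.unique key)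

theorem HasAuxTrace.intertwine_right {A : Module.End ℂ (MvPolynomial (Fin (n + 1)) ℂ)}
    {Q : Module.End ℂ (MvPolynomial (Fin n) ℂ)} (h : HasAuxTrace A Q) (hA : DiagDecay A)
    {up um : ℂ} (hup : up - 1 ≠ 0) (hum : um ≠ 0)
    {S' T' : Matrix (Fin 2) (Fin 2) (Module.End ℂ (MvPolynomial (Fin (n + 1)) ℂ))}
    {S T : Matrix (Fin 2) (Fin 2) (Module.End ℂ (MvPolynomial (Fin n) ℂ))}
    (hS : ∀ a b, IsLift (S' a b) (S a b)) (hT : ∀ a b, IsLift (T' a b) (T a b))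
    (hTc : ∀ a b, CoeffContinuous (T a b))
    (hrel : lax 0 up um * (T' * Matrix.scalar (Fin 2) A) =
      Matrix.scalar (Fin 2) A * S' * lax 0 up um) :
    T.trace * Q = Q * S.trace :=
  (h.intertwine_left hA hup hum hS hT hTc hrel.symm).symm

end TraceCyclicity

end SpinChain

namespace SpinChain

open MvPolynomial Filter Topology

/-! ### Polynomial dependence on the spectral parameter. -/

section PolynomialFamilies

variable {σ : Type}

/-- Families of polynomials that depend polynomially on a parameter. -/
def polyFamilies (σ : Type) : Submodule ℂ (ℂ → MvPolynomial σ ℂ) :=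
  Submodule.span ℂ (Set.range fun x : ℕ × MvPolynomial σ ℂ => fun u => u ^ x.1 • x.2)

theorem polyFamilies_map (A : Module.End ℂ (MvPolynomial σ ℂ)) {p : ℂ → MvPolynomial σ ℂ}
    (hp : p ∈ polyFamilies σ) : (fun u => A (p u)) ∈ polyFamilies σ := by
  induction hp using Submodule.span_induction with
  | mem p hp =>
    obtain ⟨⟨i, φ⟩, rfl⟩ := hp
    refine Submodule.subset_span ⟨⟨i, A φ⟩, ?_⟩
    ext1 u; simp
  | zero => simp only [Pi.zero_apply, map_zero]; exact (polyFamilies σ).zero_mem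
  | add p q _ _ hp hq => simpa [Pi.add_def] using (polyFamilies σ).add_mem hp hq
  | smul c p _ hp => simpa [Pi.smul_def] using (polyFamilies σ).smul_mem c hp

theorem polyFamilies_smul {p : ℂ → MvPolynomial σ ℂ} (hp : p ∈ polyFamilies σ) :
    (fun u => u • p u) ∈ polyFamilies σ := by
  induction hp using Submodule.span_induction with
  | mem p hp =>
    obtain ⟨⟨i, φ⟩, rfl⟩ := hp
    refine Submodule.subset_span ⟨⟨i + 1, φ⟩, ?_⟩
    ext1 u; simp [pow_succ', smul_smul]
  | zero => simp only [Pi.zero_apply, smul_zero]; exact (polyFamilies σ).zero_mem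
  | add p q _ _ hp hq => simpa [Pi.add_def] using (polyFamilies σ).add_mem hp hq
  | smul c p _ hp =>
    have := (polyFamilies σ).smul_mem c hp
    simpa [smul_comm c, Pi.smul_def] using this

theorem polyFamilies_const (φ : MvPolynomial σ ℂ) : (fun _ => φ) ∈ polyFamilies σ :=
  Submodule.subset_span ⟨⟨0, φ⟩, by simp⟩

theorem polyFamilies_continuous {p : ℂ → MvPolynomial σ ℂ} (hp : p ∈ polyFamilies σ)
    (d : σ →₀ ℕ) : Continuous fun u => (p u).coeff d := by
  induction hp using Submodule.span_induction with
  | mem p hp =>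
    obtain ⟨⟨i, φ⟩, rfl⟩ := hp
    simp only [coeff_smul, smul_eq_mul]
    fun_prop
  | zero => simpa using continuous_const
  | add p q _ _ hp hq => simpa [Pi.add_def] using hp.add hq
  | smul c p _ hp => simpa using hp.const_mul c

/-- The coefficients are continuous in the parameter and the complement of a finite set is dense. -/
theorem polyFamilies_ext {p q : ℂ → MvPolynomial σ ℂ} (hp : p ∈ polyFamilies σ)
    (hq : q ∈ polyFamilies σ) {s : Set ℂ} (hs : s.Finite) (h : ∀ u ∉ s, p u = q u) (u : ℂ) :
    p u = q u := by
  refine MvPolynomial.ext _ _ fun d => ?_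
  have hd : Dense sᶜ := hs.countable.dense_compl ℂ
  exact congrFun (Continuous.ext_on hd (polyFamilies_continuous hp d)
    (polyFamilies_continuous hq d) fun v hv => by rw [h v hv]) u

theorem lax_add (i : σ) (u a b : ℂ) (x y : Fin 2) :
    lax i (u + a) (u + b) x y =
      u • (1 : Matrix (Fin 2) (Fin 2) (Module.End ℂ (MvPolynomial σ ℂ))) x y + lax i a b x y := by
  fin_cases x <;> fin_cases y
  · simp [lax]; module
  · simp [lax]
  · simp [lax]
  · simp [lax]; module

theorem polyFamilies_lax_prod {m : ℕ} (s : Fin m → σ) (a b : Fin m → ℂ) (x y : Fin 2)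
    {p : ℂ → MvPolynomial σ ℂ} (hp : p ∈ polyFamilies σ) :
    (fun u => (List.ofFn fun k => lax (s k) (u + a k) (u + b k)).prod x y (p u)) ∈
      polyFamilies σ := by
  induction m generalizing x y with
  | zero =>
    simp only [List.ofFn_zero, List.prod_nil]
    exact polyFamilies_map _ hp
  | succ m ih =>
    have key : ∀ z, (fun u => lax (s 0) (u + a 0) (u + b 0) x z
        ((List.ofFn fun k : Fin m => lax (s k.succ) (u + a k.succ) (u + b k.succ)).prod z y (p u)))
        ∈ polyFamilies σ := by
      intro z
      have h1 := ih (fun k => s k.succ) (fun k => a k.succ) (fun k => b k.succ) z y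
      simp only [lax_add (s 0), LinearMap.add_apply, LinearMap.smul_apply]
      exact (polyFamilies σ).add_mem (polyFamilies_smul (polyFamilies_map _ h1))
        (polyFamilies_map _ h1)
    simp only [List.ofFn_succ, List.prod_cons, Matrix.mul_apply, Fin.sum_univ_two,
      LinearMap.add_apply, Module.End.mul_apply]
    exact (polyFamilies σ).add_mem (key 0) (key 1)

theorem transferMatrix_apply {n : ℕ} (up um : Fin n → ℂ) (Ψ : MvPolynomial (Fin n) ℂ) :
    transferMatrix up um Ψ = (List.ofFn fun k => lax k (up k) (um k)).prod 0 0 Ψ +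
      (List.ofFn fun k => lax k (up k) (um k)).prod 1 1 Ψ := by
  rw [transferMatrix, Matrix.trace_fin_two, LinearMap.add_apply]

theorem polyFamilies_transferMatrix {n : ℕ} (a b : Fin n → ℂ) (Ψ : MvPolynomial (Fin n) ℂ) :
    (fun u => transferMatrix (fun k => u + a k) (fun k => u + b k) Ψ) ∈ polyFamilies (Fin n) := by
  simp only [transferMatrix_apply]
  exact (polyFamilies _).add_mem (polyFamilies_lax_prod _ _ _ _ _ (polyFamilies_const Ψ))
    (polyFamilies_lax_prod _ _ _ _ _ (polyFamilies_const Ψ))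

/-- An intertwining relation of transfer matrices that holds outside a finite set of spectral
parameters holds everywhere. -/
theorem transferMatrix_intertwine_of_generic {n : ℕ} {Q : Module.End ℂ (MvPolynomial (Fin n) ℂ)}
    {a b c d : Fin n → ℂ} {s : Set ℂ} (hs : s.Finite)
    (h : ∀ u ∉ s, Q * transferMatrix (fun k => u + a k) (fun k => u + b k) =
      transferMatrix (fun k => u + c k) (fun k => u + d k) * Q) (u : ℂ) :
    Q * transferMatrix (fun k => u + a k) (fun k => u + b k) =
      transferMatrix (fun k => u + c k) (fun k => u + d k) * Q :=
  LinearMap.ext fun Ψ => polyFamilies_ext (polyFamilies_map Q (polyFamilies_transferMatrix a b Ψ))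
    (polyFamilies_transferMatrix c d (Q Ψ)) hs (fun v hv => LinearMap.congr_fun (h v hv) Ψ) u

end PolynomialFamilies

/-! ### Intertwining relations of the transfer matrices, given decay of the monodromy. -/

section TransferMatrices

variable {n : ℕ} [NeZero n]

/-- Reduction of an index modulo `n`. -/
def wrap (j : Fin (n + 1)) : Fin n := Fin.ofNat n j

theorem wrap_castSucc (k : Fin n) : wrap k.castSucc = k :=
  Fin.ext (Nat.mod_eq_of_lt k.isLt)

theorem wrap_succ (k : Fin n) : wrap k.succ = k + 1 := by
  ext; simp [wrap, Fin.val_add]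

theorem wrap_zero : wrap (0 : Fin (n + 1)) = 0 := by
  ext; simp [wrap]

theorem wrap_last : wrap (Fin.last n) = 0 := by
  ext; simp [wrap]

/-- Cyclicity of the trace over `ℂ²` needs entries that commute, as those of Lax matrices at
different sites do. -/
theorem trace_mul_comm_of_commute {R : Type} [Ring R] {A B : Matrix (Fin 2) (Fin 2) R}
    (h : ∀ a b c d, Commute (A a b) (B c d)) : (A * B).trace = (B * A).trace := by
  simp only [Matrix.trace_fin_two, Matrix.mul_apply, Fin.sum_univ_two, (h _ _ _ _).eq]
  abel

theorem commute_lax_entry {σ : Type} {k : σ} {A : Module.End ℂ (MvPolynomial σ ℂ)}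
    (hz : Commute A (mulZ k)) (hd : Commute A (diffZ k)) (up um : ℂ) (a b : Fin 2) :
    Commute A (lax k up um a b) := by
  have h1 : ∀ c : ℂ, Commute A (c • 1) := fun c => (Commute.one_right A).smul_right c
  fin_cases a <;> fin_cases b
  · exact (h1 _).add_right (hz.mul_right hd)
  · exact hd.neg_right
  · exact ((hz.pow_right 2).mul_right hd).add_right (hz.smul_right _)
  · exact (h1 _).sub_right (hz.mul_right hd)

theorem commute_lax_lax {σ : Type} {k k' : σ} (h : k ≠ k') (up um vp vm : ℂ) (a b c d : Fin 2) :
    Commute (lax k up um a b) (lax k' vp vm c d) :=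
  commute_lax_entry
    (commute_lax_entry (mulZ_comm _ _) (diffZ_mulZ_of_ne h).symm _ _ _ _).symm
    (commute_lax_entry (diffZ_mulZ_of_ne h.symm) (diffZ_comm _ _) _ _ _ _).symm _ _ _ _

theorem commute_lax_prod {σ : Type} {m : ℕ} {A : Module.End ℂ (MvPolynomial σ ℂ)} {s : Fin m → σ}
    {up um : Fin m → ℂ} (h : ∀ k a b, Commute A (lax (s k) (up k) (um k) a b)) (a b : Fin 2) :
    Commute A ((List.ofFn fun k => lax (s k) (up k) (um k)).prod a b) := by
  induction m generalizing a b with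
  | zero =>
    by_cases hab : a = b
    · subst hab; simp
    · simp [hab]
  | succ m ih =>
    simp only [List.ofFn_succ, List.prod_cons, Matrix.mul_apply, Fin.sum_univ_two]
    exact ((h 0 _ _).mul_right (ih (fun k => h k.succ) _ _)).add_right
      ((h 0 _ _).mul_right (ih (fun k => h k.succ) _ _))

theorem scalar_mul_trace {R : Type} [Ring R] (A : R) (M : Matrix (Fin 2) (Fin 2) R) :
    (Matrix.scalar (Fin 2) A * M).trace = A * M.trace := by
  rw [M.eta_fin_two, scalar_mul_fin_two, Matrix.trace_fin_two, Matrix.trace_fin_two]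
  simp [mul_add]

theorem trace_mul_scalar {R : Type} [Ring R] (A : R) (M : Matrix (Fin 2) (Fin 2) R) :
    (M * Matrix.scalar (Fin 2) A).trace = M.trace * A := by
  rw [M.eta_fin_two, fin_two_mul_scalar, Matrix.trace_fin_two, Matrix.trace_fin_two]
  simp [add_mul]

theorem trace_rotate (up um : Fin n → ℂ) :
    ((List.ofFn fun k => lax (k + 1) (up (k + 1)) (um (k + 1))).prod).trace =
      transferMatrix up um := by
  obtain ⟨m, rfl⟩ : ∃ m, n = m + 1 := ⟨n - 1, by have := NeZero.pos n; omega⟩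
  have h0 : ∀ k : Fin m, k.succ ≠ 0 := Fin.succ_ne_zero
  rw [transferMatrix, List.ofFn_succ', List.ofFn_succ, List.concat_eq_append, List.prod_append,
    List.prod_singleton, List.prod_cons, Fin.last_add_one]
  simp only [Fin.coeSucc_eq_succ]
  refine trace_mul_comm_of_commute fun a b c d => ?_
  exact (commute_lax_prod (fun k _ _ => commute_lax_lax (h0 k).symm _ _ _ _ _ _ _ _) _ _).symm

theorem cyclicShift_mul_transferMatrix (up um : Fin n → ℂ) :
    cyclicShift n * transferMatrix up um =
      transferMatrix (fun k => up (k - 1)) (fun k => um (k - 1)) * cyclicShift n := by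
  have hinj : Function.Injective fun k : Fin n => k + 1 := add_left_injective 1
  have hloc : ∀ (k : Fin n) (a b : ℂ), Matrix.scalar (Fin 2) (cyclicShift n) * lax k a b =
      lax (k + 1) a b * Matrix.scalar (Fin 2) (cyclicShift n) := fun k a b =>
    scalar_mul_lax_of_intertwine (renameOp_mulZ _ k) (renameOp_diffZ hinj k) a b
  have hprod : ∀ (m : ℕ) (s : Fin m → Fin n) (a b : Fin m → ℂ),
      Matrix.scalar (Fin 2) (cyclicShift n) * (List.ofFn fun k => lax (s k) (a k) (b k)).prod =
      (List.ofFn fun k => lax (s k + 1) (a k) (b k)).prod *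
        Matrix.scalar (Fin 2) (cyclicShift n) := by
    intro m
    induction m with
    | zero => simp
    | succ m ih =>
      intro s a b
      simp only [List.ofFn_succ, List.prod_cons]
      rw [← mul_assoc, hloc, mul_assoc, ih, mul_assoc]
  have hr := trace_rotate (fun k => up (k - 1)) (fun k => um (k - 1))
  simp only [add_sub_cancel_right] at hr
  rw [← hr, transferMatrix, ← scalar_mul_trace, ← trace_mul_scalar, hprod]

variable (l δ : Fin n → ℂ) (lam : ℂ)

theorem intertwine_minus (hl : ∀ (k : Fin n) (j : ℕ), 2 * l k ≠ -(j : ℂ))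
    {Q : Module.End ℂ (MvPolynomial (Fin n) ℂ)} (hQ : HasAuxTrace (monodromyMinus l δ lam) Q)
    (hdec : DiagDecay (monodromyMinus l δ lam)) (u : ℂ) :
    Q * transferMatrix (fun k => u + δ k + l k) (fun k => u + δ k - l k) =
      transferMatrix (fun k => u + δ (k + 1) + l (k + 1)) (fun k => u + δ k - l k) * Q := by
  have key := transferMatrix_intertwine_of_generic (Q := Q) (a := fun k => δ k + l k)
    (b := fun k => δ k - l k) (c := fun k => δ (k + 1) + l (k + 1)) (d := fun k => δ k - l k)
    -- These are the zeros of `up - 1` and of `um` for the auxiliary Lax matrix chosen below.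
    (s := {1 - (δ 0 + l 0), lam}) (by simp) ?_ u
  · simpa only [← add_assoc, ← add_sub_assoc] using key
  intro v hv
  simp only [Set.mem_insert_iff, Set.mem_singleton_iff, not_or] at hv
  -- The auxiliary minus parameter `v - lam` is forced by `w k + l k = up k - v` in `chain_minus`.
  -- Since `wrap` takes the same value at `0` and at `Fin.last n`, the auxiliary matrix is the same
  -- on both sides and can be cancelled.
  have hc := chain_minus n Fin.succ (Fin.succ_injective n) (o := 0) Fin.succ_ne_zero l
    (fun k => lam + δ k) (fun k => v + (δ k - l k))
    (fun j => v + (δ (wrap j) + l (wrap j))) (v - lam) hl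
    (fun k => by simp only [wrap_castSucc]; ring) (fun k => by simp only [wrap_castSucc]; ring)
  simp only [wrap_castSucc, wrap_succ, wrap_zero, wrap_last, ← mul_assoc] at hc
  rw [mul_assoc (lax 0 _ _)] at hc
  refine hQ.intertwine_left hdec (up := v + (δ 0 + l 0)) (um := v - lam)
    (fun h => hv.1 (by linear_combination h)) (sub_ne_zero.2 hv.2)
    (fun a b => isLift_lax_prod id _ _ a b) (fun a b => isLift_lax_prod id _ _ a b)
    (fun a b => coeffContinuous_lax_prod id _ _ a b) hc

theorem intertwine_plus (hl : ∀ (k : Fin n) (j : ℕ), 1 + l k - (lam + δ k) ≠ -(j : ℂ))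
    {Q : Module.End ℂ (MvPolynomial (Fin n) ℂ)} (hQ : HasAuxTrace (monodromyPlus l δ lam) Q)
    (hdec : DiagDecay (monodromyPlus l δ lam)) (u : ℂ) :
    transferMatrix (fun k => u + δ k + l k) (fun k => u + δ k - l k) * Q =
      Q * transferMatrix (fun k => u + δ k + l k) (fun k => u + δ (k - 1) - l (k - 1)) := by
  have key := transferMatrix_intertwine_of_generic (Q := Q) (a := fun k => δ k + l k)
    (b := fun k => δ (k - 1) - l (k - 1)) (c := fun k => δ k + l k) (d := fun k => δ k - l k)
    (s := {lam, l (0 - 1) - δ (0 - 1)}) (by simp) ?_ u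
  · simpa only [← add_assoc, ← add_sub_assoc] using key.symm
  intro v hv
  simp only [Set.mem_insert_iff, Set.mem_singleton_iff, not_or] at hv
  -- The auxiliary plus parameter is forced to be `1 + v - lam`. Index `j` carries the minus
  -- parameter of the site preceding `wrap j`, so both ends carry that of the last site.
  have hc := chain_plus n Fin.succ (Fin.succ_injective n) (o := 0) Fin.succ_ne_zero l
    (fun k => lam + δ k) (fun k => v + (δ k + l k))
    (fun j => v + (δ (wrap j - 1) - l (wrap j - 1))) (1 + v - lam) hl
    (fun k => by simp only [wrap_succ, add_sub_cancel_right]; ring)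
    (fun k => by simp only [wrap_succ, add_sub_cancel_right]; ring)
  simp only [wrap_castSucc, wrap_succ, wrap_zero, wrap_last, add_sub_cancel_right] at hc
  rw [← mul_assoc (Matrix.scalar (Fin 2) _)] at hc
  refine (hQ.intertwine_right hdec (up := 1 + v - lam) (um := v + (δ (0 - 1) - l (0 - 1)))
    (fun h => hv.1 (by linear_combination h)) (fun h => hv.2 (by linear_combination h))
    (fun a b => isLift_lax_prod id _ _ a b) (fun a b => isLift_lax_prod id _ _ a b)
    (fun a b => coeffContinuous_lax_prod id _ _ a b) hc).symm

end TransferMatrices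

end SpinChain

namespace SpinChain

open MvPolynomial Filter Topology
open Finset.HasAntidiagonal (antidiagonal)
open Finsupp (single)

/-! ### Finite differences of Pochhammer quotients. -/

section FiniteDifferences

/-- Iterated finite differences `∑ᵢ (-1)ⁱ (N choose i) f (s + i)`. -/
def finDiff (f : ℕ → ℂ) : ℕ → ℕ → ℂ
  | 0, s => f s
  | N + 1, s => finDiff f N s - finDiff f N (s + 1)

theorem ascPochhammer_eval_eq_prod (c : ℂ) (N : ℕ) :
    (ascPochhammer ℂ N).eval c = ∏ j ∈ Finset.range N, (c + j) := by
  induction N with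
  | zero => simp
  | succ N ih => rw [ascPochhammer_succ_eval, ih, Finset.prod_range_succ]

theorem ascPochhammer_eval_ne_zero {c : ℂ} (hc : ∀ j : ℕ, c ≠ -j) (N : ℕ) :
    (ascPochhammer ℂ N).eval c ≠ 0 := by
  rw [ascPochhammer_eval_eq_prod]
  exact Finset.prod_ne_zero_iff.2 fun j _ h => hc j (by linear_combination h)

/-- A form of the Chu–Vandermonde identity. The induction step is `1 - (a + s) / (b + N + s) = (b -
a + N) / (b + N + s)`. -/
theorem finDiff_gammaRatio (a b : ℂ) (hb : ∀ j : ℕ, b ≠ -j) (N s : ℕ) :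
    finDiff (gammaRatio a b) N s = (ascPochhammer ℂ s).eval a * (ascPochhammer ℂ N).eval (b - a) /
      (ascPochhammer ℂ (N + s)).eval b := by
  induction N generalizing s with
  | zero => simp [finDiff, gammaRatio]
  | succ N ih =>
    have h1 := ascPochhammer_eval_ne_zero hb (N + s)
    have h2 : b + ((N + s : ℕ) : ℂ) ≠ 0 := fun h => hb (N + s) (by linear_combination h)
    rw [finDiff, ih, ih, ascPochhammer_succ_eval, ascPochhammer_succ_eval, ← add_assoc,
      show N + 1 + s = N + s + 1 by ring, ascPochhammer_succ_eval]
    field_simp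
    push_cast
    ring

/-- Re-expands in powers of `x` a combination of powers of `x - y` weighted by `f`. The induction
uses Pascal's rule on both sides; the offset `s` is there because that rule shifts the argument of
`f`. -/
theorem sum_finDiff {S : Type} [CommRing S] [Algebra ℂ S] (f : ℕ → ℂ) (x y : S) (m s : ℕ) :
    ∑ ij ∈ antidiagonal m,
        (m.choose ij.1 : S) * (f (s + ij.1) • ((x - y) ^ ij.1 * y ^ ij.2)) =
      ∑ ij ∈ antidiagonal m,
        (m.choose ij.1 : S) * (finDiff f ij.2 (s + ij.1) • (x ^ ij.1 * y ^ ij.2)) := by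
  induction m generalizing s with
  | zero => simp [finDiff]
  | succ m ih =>
    rw [Finset.sum_antidiagonal_choose_succ_mul
        (fun i j => f (s + i) • ((x - y) ^ i * y ^ j)),
      Finset.sum_antidiagonal_choose_succ_mul
        (fun i j => finDiff f j (s + i) • (x ^ i * y ^ j))]
    have hsymm : ∀ g : ℕ → ℕ → S, ∑ ij ∈ antidiagonal m, (m.choose ij.2 : S) * g ij.1 ij.2 =
        ∑ ij ∈ antidiagonal m, (m.choose ij.1 : S) * g ij.1 ij.2 := fun g =>
      Finset.sum_congr rfl fun ij h => by
        rw [Nat.choose_symm_of_eq_add (Finset.HasAntidiagonal.mem_antidiagonal.1 h).symm]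
    have e1 : ∑ ij ∈ antidiagonal m,
        (m.choose ij.1 : S) * (f (s + ij.1) • ((x - y) ^ ij.1 * y ^ (ij.2 + 1))) =
        y * ∑ ij ∈ antidiagonal m,
          (m.choose ij.1 : S) * (f (s + ij.1) • ((x - y) ^ ij.1 * y ^ ij.2)) := by
      rw [Finset.mul_sum]
      refine Finset.sum_congr rfl fun ij _ => ?_
      simp only [Algebra.smul_def]; ring
    have e2 : ∑ ij ∈ antidiagonal m,
        (m.choose ij.1 : S) * (f (s + (ij.1 + 1)) • ((x - y) ^ (ij.1 + 1) * y ^ ij.2)) =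
        (x - y) * ∑ ij ∈ antidiagonal m,
          (m.choose ij.1 : S) * (f (s + 1 + ij.1) • ((x - y) ^ ij.1 * y ^ ij.2)) := by
      rw [Finset.mul_sum]
      refine Finset.sum_congr rfl fun ij _ => ?_
      rw [show s + (ij.1 + 1) = s + 1 + ij.1 by ring]
      simp only [Algebra.smul_def]; ring
    rw [hsymm fun i j => f (s + (i + 1)) • ((x - y) ^ (i + 1) * y ^ j),
      hsymm fun i j => finDiff f j (s + (i + 1)) • (x ^ (i + 1) * y ^ j), e1, e2, ih, ih,
      Finset.mul_sum, Finset.mul_sum, ← Finset.sum_add_distrib, ← Finset.sum_add_distrib]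
    refine Finset.sum_congr rfl fun ij _ => ?_
    rw [finDiff, show s + (ij.1 + 1) = s + 1 + ij.1 by ring,
      show s + ij.1 + 1 = s + 1 + ij.1 by ring]
    simp only [Algebra.smul_def, map_sub]; ring

end FiniteDifferences

/-! ### Action of the local factors on monomials. -/

section MonomialAction

variable {σ : Type}

theorem monomial_mul_X_pow_mul_X_pow (i j : σ) (e : σ →₀ ℕ) (a : ℂ) (m p : ℕ) :
    monomial e a * (X i ^ m * X j ^ p) = monomial (e + single i m + single j p) a := by
  rw [X_pow_eq_monomial, X_pow_eq_monomial, monomial_mul, monomial_mul, one_mul, mul_one,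
    add_assoc]

theorem coeff_apply_eq_sum (A : Module.End ℂ (MvPolynomial σ ℂ)) (p : MvPolynomial σ ℂ)
    (q : σ →₀ ℕ) :
    (A p).coeff q = ∑ d ∈ p.support, (A (monomial d (p.coeff d))).coeff q := by
  conv_lhs => rw [p.as_sum, map_sum, coeff_sum]

/-- `A` preserves the total degree and the exponents of the variables outside `S`. -/
def Moves (S : Set σ) (A : Module.End ℂ (MvPolynomial σ ℂ)) : Prop :=
  ∀ d c q, (A (monomial d c)).coeff q ≠ 0 → q.degree = d.degree ∧ ∀ x ∉ S, q x = d x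

theorem Moves.mul {S S' : Set σ} {A B : Module.End ℂ (MvPolynomial σ ℂ)} (hA : Moves S A)
    (hB : Moves S' B) : Moves (S ∪ S') (A * B) := by
  intro d c q h
  rw [Module.End.mul_apply, coeff_apply_eq_sum] at h
  obtain ⟨d', hd', h'⟩ := Finset.exists_ne_zero_of_sum_ne_zero h
  obtain ⟨h1, h2⟩ := hA _ _ _ h'
  obtain ⟨h3, h4⟩ := hB _ _ _ (MvPolynomial.mem_support_iff.1 hd')
  refine ⟨h1.trans h3, fun x hx => ?_⟩
  rw [Set.mem_union, not_or] at hx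
  rw [h2 x hx.1, h4 x hx.2]

variable [DecidableEq σ] {i j : σ}

theorem translate_monomial_of_eq_zero (c : ℂ) {e : σ →₀ ℕ} (he : e i = 0) (a : ℂ) :
    translate i j c (monomial e a) = monomial e a := by
  rw [translate, aeval_monomial, monomial_eq]
  congr 1
  refine Finsupp.prod_congr fun k hk => ?_
  have : k ≠ i := by rintro rfl; exact Finsupp.mem_support_iff.1 hk he
  simp [this]

/-- The action of `f(z_{ij} ∂_i)` on monomials. -/
theorem relEulerFun_monomial (f : ℕ → ℂ) (hij : i ≠ j) {e : σ →₀ ℕ} (hi : e i = 0) (m p : ℕ)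
    (a : ℂ) : relEulerFun f i j (monomial (e + single i m + single j p) a) =
      ∑ ts ∈ antidiagonal m, monomial (e + single i ts.1 + single j (ts.2 + p))
        ((m.choose ts.1 : ℂ) * finDiff f ts.2 ts.1 * a) := by
  have ht : ∀ (c : ℂ) (r q : ℕ), translate i j c (monomial e a * (X i ^ r * X j ^ q)) =
      monomial e a * ((X i + C c * X j) ^ r * X j ^ q) := by
    intro c r q
    rw [map_mul, translate_monomial_of_eq_zero c hi]
    simp [translate, hij.symm]
  have he : ∀ r q : ℕ, eulerFun i f (monomial e a * (X i ^ r * X j ^ q)) =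
      f r • (monomial e a * (X i ^ r * X j ^ q)) := by
    intro r q
    rw [monomial_mul_X_pow_mul_X_pow, eulerFun_monomial]
    simp [hi, hij]
  -- Translating expands in powers of `X i`, the Euler function weights them, and translating back
  -- turns them into powers of `X i - X j`; `hsum` returns to monomials.
  have hsum := sum_finDiff f (X i : MvPolynomial σ ℂ) (X j) m 0
  simp only [zero_add] at hsum
  have hfin : ∀ t s : ℕ, monomial (e + single i t + single j (s + p))
        ((m.choose t : ℂ) * finDiff f s t * a) = monomial e a * X j ^ p *
        ((m.choose t : MvPolynomial σ ℂ) * (finDiff f s t • (X i ^ t * X j ^ s))) := by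
    intro t s
    rw [← smul_eq_mul, ← smul_monomial, ← monomial_mul_X_pow_mul_X_pow, pow_add, mul_smul]
    simp only [smul_eq_C_mul, map_natCast]
    ring
  simp only [hfin, ← Finset.mul_sum]
  rw [← hsum, ← monomial_mul_X_pow_mul_X_pow]
  show translate i j (-1) (eulerFun i f (translate i j 1 _)) = _
  have h1 : translate i j 1 (monomial e a * (X i ^ m * X j ^ p)) =
      ∑ ts ∈ antidiagonal m, (m.choose ts.1 : ℂ) •
        (monomial e a * (X i ^ ts.1 * X j ^ (ts.2 + p))) := by
    rw [ht, map_one, one_mul, (Commute.all _ _).add_pow', Finset.sum_mul, Finset.mul_sum]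
    refine Finset.sum_congr rfl fun ts _ => ?_
    simp only [nsmul_eq_mul, smul_eq_C_mul, map_natCast]
    ring
  rw [h1, map_sum, map_sum, Finset.mul_sum]
  refine Finset.sum_congr rfl fun ts _ => ?_
  rw [map_smul, he, map_smul, map_smul, ht]
  simp only [smul_eq_C_mul, map_natCast, map_neg, map_one]
  ring

variable {k o : σ}

theorem permOp_monomial {e : σ →₀ ℕ} (hk : e k = 0) (ho : e o = 0) (t r : ℕ) (a : ℂ) :
    permOp k o (monomial (e + single k t + single o r) a) =
      monomial (e + single k r + single o t) a := by
  have he : e.mapDomain (Equiv.swap k o) = e := by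
    conv_rhs => rw [← Finsupp.mapDomain_id (v := e)]
    refine Finsupp.mapDomain_congr fun x hx => ?_
    have hx' := Finsupp.mem_support_iff.1 hx
    exact Equiv.swap_apply_of_ne_of_ne (by rintro rfl; exact hx' hk) (by rintro rfl; exact hx' ho)
  show rename (Equiv.swap k o) _ = _
  rw [rename_monomial, Finsupp.mapDomain_add, Finsupp.mapDomain_add, he,
    Finsupp.mapDomain_single, Finsupp.mapDomain_single, Equiv.swap_apply_left,
    Equiv.swap_apply_right, add_right_comm]

theorem siteMinus_monomial (l u : ℂ) (hko : k ≠ o) {e : σ →₀ ℕ} (hk : e k = 0) (ho : e o = 0)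
    (p m : ℕ) (a : ℂ) : siteMinus l u k o (monomial (e + single k p + single o m) a) =
      ∑ ts ∈ antidiagonal p, monomial (e + single k (ts.2 + m) + single o ts.1)
        ((p.choose ts.1 : ℂ) * finDiff (gammaRatio (u + l) (2 * l)) ts.2 ts.1 * a) := by
  rw [siteMinus, Module.End.mul_apply, rMinus, relEulerFun_monomial _ hko hk, map_sum]
  exact Finset.sum_congr rfl fun ts _ => permOp_monomial hk ho _ _ _

theorem sitePlus_monomial (l u : ℂ) (hko : k ≠ o) {e : σ →₀ ℕ} (hk : e k = 0) (ho : e o = 0)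
    (p m : ℕ) (a : ℂ) : sitePlus l u k o (monomial (e + single k p + single o m) a) =
      ∑ ts ∈ antidiagonal m, monomial (e + single k ts.1 + single o (ts.2 + p))
        ((m.choose ts.1 : ℂ) * finDiff (gammaRatio (2 * l) (1 + l - u)) ts.2 ts.1 * a) := by
  rw [sitePlus, Module.End.mul_apply, rPlus, add_right_comm,
    relEulerFun_monomial _ hko.symm ho, map_sum]
  refine Finset.sum_congr rfl fun ts _ => ?_
  rw [add_right_comm, permOp_monomial hk ho]

theorem exists_eq_add_single (hko : k ≠ o) (d : σ →₀ ℕ) :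
    ∃ e : σ →₀ ℕ, e k = 0 ∧ e o = 0 ∧ d = e + single k (d k) + single o (d o) := by
  refine ⟨(d.erase k).erase o, by simp [Finsupp.erase_ne hko], by simp, ?_⟩
  ext x
  by_cases hk : x = k
  · subst hk; simp [hko, Finsupp.erase_ne hko]
  · by_cases ho : x = o
    · subst ho; simp [hk]
    · simp [Finsupp.erase_ne hk, Finsupp.erase_ne ho, hk, ho]

theorem Moves.one : Moves ∅ (1 : Module.End ℂ (MvPolynomial σ ℂ)) := by
  intro d c q h
  rw [Module.End.one_apply, coeff_monomial] at h
  have : d = q := by by_contra hne; simp [hne] at h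
  subst this
  exact ⟨rfl, fun _ _ => rfl⟩

theorem moves_of_monomial (hko : k ≠ o) {A : Module.End ℂ (MvPolynomial σ ℂ)}
    (h : ∀ (e : σ →₀ ℕ), e k = 0 → e o = 0 → ∀ (p m : ℕ) (a : ℂ),
      ∃ (s : Finset (ℕ × ℕ)) (f : ℕ × ℕ → ℂ), (∀ x ∈ s, x.1 + x.2 = p + m) ∧
      A (monomial (e + single k p + single o m) a) =
        ∑ x ∈ s, monomial (e + single k x.1 + single o x.2) (f x)) : Moves {k, o} A := by
  intro d c q hq
  obtain ⟨e, hk, ho, hd⟩ := exists_eq_add_single hko d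
  obtain ⟨s, f, hs, hA⟩ := h e hk ho (d k) (d o) c
  rw [← hd] at hA
  rw [hA, coeff_sum] at hq
  obtain ⟨x, hx, hx'⟩ := Finset.exists_ne_zero_of_sum_ne_zero hq
  rw [coeff_monomial] at hx'
  have hqe : e + single k x.1 + single o x.2 = q := by by_contra hne; simp [hne] at hx'
  subst hqe
  constructor
  · conv_rhs => rw [hd]
    simp only [map_add, Finsupp.degree_single]
    have := hs x hx
    omega
  · intro y hy
    simp only [Set.mem_insert_iff, Set.mem_singleton_iff, not_or] at hy
    conv_rhs => rw [hd]
    simp [hy.1, hy.2]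

theorem moves_siteMinus (l u : ℂ) (hko : k ≠ o) : Moves {k, o} (siteMinus l u k o) := by
  refine moves_of_monomial hko fun e hk ho p m a => ?_
  -- The coefficient must be a function of the resulting pair of exponents, so the order of the
  -- difference is recovered as `x.1 - m`.
  refine ⟨(antidiagonal p).image fun ts => (ts.2 + m, ts.1), fun x =>
    (p.choose x.2 : ℂ) * finDiff (gammaRatio (u + l) (2 * l)) (x.1 - m) x.2 * a, ?_, ?_⟩
  · intro x hx
    obtain ⟨ts, hts, rfl⟩ := Finset.mem_image.1 hx
    have := Finset.HasAntidiagonal.mem_antidiagonal.1 hts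
    dsimp only; omega
  · rw [siteMinus_monomial l u hko hk ho, Finset.sum_image]
    · simp
    · rintro ⟨a, b⟩ - ⟨c, d⟩ - h
      simp only [Prod.mk.injEq] at h ⊢; omega

theorem moves_sitePlus (l u : ℂ) (hko : k ≠ o) : Moves {k, o} (sitePlus l u k o) := by
  refine moves_of_monomial hko fun e hk ho p m a => ?_
  refine ⟨(antidiagonal m).image fun ts => (ts.1, ts.2 + p), fun x =>
    (m.choose x.1 : ℂ) * finDiff (gammaRatio (2 * l) (1 + l - u)) (x.2 - p) x.1 * a, ?_, ?_⟩
  · intro x hx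
    obtain ⟨ts, hts, rfl⟩ := Finset.mem_image.1 hx
    have := Finset.HasAntidiagonal.mem_antidiagonal.1 hts
    dsimp only; omega
  · rw [sitePlus_monomial l u hko hk ho, Finset.sum_image]
    · simp
    · rintro ⟨a, b⟩ - ⟨c, d⟩ - h
      simp only [Prod.mk.injEq] at h ⊢; omega

/-- The new exponent of `z_o` after `P_{ko} R⁻_{ko}` is at most the old exponent of `z_k`. -/
theorem siteMinus_coeff_eq_zero (l u : ℂ) (hko : k ≠ o) {F : MvPolynomial σ ℂ} {p : ℕ}
    (hF : ∀ d, F.coeff d ≠ 0 → d k = p) {q : σ →₀ ℕ} (hq : p < q o) :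
    (siteMinus l u k o F).coeff q = 0 := by
  rw [coeff_apply_eq_sum]
  refine Finset.sum_eq_zero fun d hd => ?_
  have hp := hF d (MvPolynomial.mem_support_iff.1 hd)
  obtain ⟨e, hk, ho, hd'⟩ := exists_eq_add_single hko d
  have hm : monomial d (F.coeff d) =
    monomial (e + single k (d k) + single o (d o)) (F.coeff d) := by rw [← hd']
  rw [hm, siteMinus_monomial l u hko hk ho, coeff_sum]
  refine Finset.sum_eq_zero fun ts hts => ?_
  rw [coeff_monomial, if_neg]
  rintro rfl
  have := Finset.HasAntidiagonal.mem_antidiagonal.1 hts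
  simp [ho, hko] at hq
  omega

/-- The coefficients of `P_{ko} R⁺_{ko} F` when `F` has exponent `p` in `z_k`. -/
theorem sitePlus_coeff (l u : ℂ) (hko : k ≠ o) {F : MvPolynomial σ ℂ} {p : ℕ}
    (hF : ∀ d, F.coeff d ≠ 0 → d k = p) {e : σ →₀ ℕ} (hk : e k = 0) (ho : e o = 0) (s m : ℕ) :
    (sitePlus l u k o F).coeff (e + single k s + single o m) =
      if p ≤ m then ((m - p + s).choose s : ℂ) *
        finDiff (gammaRatio (2 * l) (1 + l - u)) (m - p) s *
          F.coeff (e + single k p + single o (m - p + s)) else 0 := by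
  have hadd : ∀ (e e' : σ →₀ ℕ), e k = 0 → e o = 0 → e' k = 0 → e' o = 0 → ∀ a b a' b' : ℕ,
      e + single k a + single o b = e' + single k a' + single o b' ↔ e = e' ∧ a = a' ∧ b = b' := by
    intro e e' h1 h2 h3 h4 a b a' b'
    constructor
    · intro h
      have ha := DFunLike.congr_fun h k
      have hb := DFunLike.congr_fun h o
      simp [h1, h2, h3, h4, hko, hko.symm] at ha hb
      subst ha hb
      exact ⟨by simpa using h, rfl, rfl⟩
    · rintro ⟨rfl, rfl, rfl⟩; rfl
  have hrhs : F.coeff (e + single k p + single o (m - p + s)) = ∑ d ∈ F.support,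
      (monomial d (F.coeff d)).coeff (e + single k p + single o (m - p + s)) := by
    conv_lhs => rw [F.as_sum, coeff_sum]
  have hterm : ∀ d ∈ F.support,
      (sitePlus l u k o (monomial d (F.coeff d))).coeff (e + single k s + single o m) =
      if p ≤ m then ((m - p + s).choose s : ℂ) *
        finDiff (gammaRatio (2 * l) (1 + l - u)) (m - p) s *
          (monomial d (F.coeff d)).coeff (e + single k p + single o (m - p + s)) else 0 := by
    intro d hd
    have hp := hF d (MvPolynomial.mem_support_iff.1 hd)
    obtain ⟨e', hk', ho', hd'⟩ := exists_eq_add_single hko d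
    rw [hp] at hd'
    generalize F.coeff d = c
    generalize d o = r at hd'
    subst hd'
    rw [sitePlus_monomial l u hko hk' ho', coeff_sum]
    simp only [coeff_monomial, hadd e' e hk' ho' hk ho]
    by_cases he : e' = e
    · subst he
      by_cases hpm : p ≤ m
      · rw [if_pos hpm]
        by_cases hr : r = m - p + s
        · subst hr
          -- For given target exponents exactly one monomial of `F` and one term of its image
          -- contribute.
          rw [Finset.sum_eq_single (s, m - p)]
          · simp [hpm]
          · rintro ⟨t, t'⟩ - hne
            rw [if_neg]
            rintro ⟨-, h1, h2⟩
            exact hne (by simp only [Prod.mk.injEq]; dsimp only at h1 h2; omega)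
          · intro h
            exact absurd (Finset.HasAntidiagonal.mem_antidiagonal.2 (by dsimp only; omega)) h
        · rw [if_neg (fun h => hr h.2.2), mul_zero]
          refine Finset.sum_eq_zero fun ts hts => if_neg ?_
          have := Finset.HasAntidiagonal.mem_antidiagonal.1 hts
          rintro ⟨-, h1, h2⟩
          omega
      · rw [if_neg hpm]
        refine Finset.sum_eq_zero fun ts _ => if_neg ?_
        rintro ⟨-, -, h2⟩
        omega
    · simp [he]
  rw [coeff_apply_eq_sum, Finset.sum_congr rfl hterm]
  by_cases hpm : p ≤ m
  · simp only [if_pos hpm]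
    rw [hrhs, Finset.mul_sum]
  · simp [hpm]

end MonomialAction

end SpinChain

namespace SpinChain

open MvPolynomial Filter Topology Asymptotics
open Finsupp (single)
open scoped Nat

/-! ### Growth of Pochhammer symbols and of the kernel of `P R⁺`. -/

section PochhammerAsymptotics

/-- Euler's limit `N ^ c * N! / (c)_{N+1} → Γ(c)`, whose value is nonzero, together with `c + N ~
N`. -/
theorem ascPochhammer_isTheta {c : ℂ} (hc : ∀ j : ℕ, c ≠ -j) :
    (fun N : ℕ => (ascPochhammer ℂ N).eval c) =Θ[atTop]
      fun N : ℕ => (N ! : ℝ) * (N : ℝ) ^ (c.re - 1) := by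
  have h1 : (fun N : ℕ => (N : ℂ) ^ c * N !) =Θ[atTop]
      fun N : ℕ => (ascPochhammer ℂ (N + 1)).eval c := by
    refine (isTheta_of_div_tendsto_nhds_ne_zero (c := Complex.Gamma c) ?_
      (Complex.Gamma_ne_zero hc)).symm
    refine (Complex.GammaSeq_tendsto_Gamma c).congr fun N => ?_
    simp [Complex.GammaSeq, ascPochhammer_eval_eq_prod]
  have h2 : (fun N : ℕ => c + (N : ℂ)) =Θ[atTop] fun N : ℕ => (N : ℂ) := by
    refine (isTheta_of_div_tendsto_nhds_ne_zero (c := 1) ?_ one_ne_zero).symm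
    have h0 : Tendsto (fun N : ℕ => c * (N : ℂ)⁻¹ + 1) atTop (𝓝 (c * 0 + 1)) :=
      (tendsto_inv_atTop_nhds_zero_nat (𝕜 := ℂ)).const_mul c |>.add_const 1
    rw [mul_zero, zero_add] at h0
    refine h0.congr' ?_
    filter_upwards [eventually_gt_atTop 0] with N hN
    have : (N : ℂ) ≠ 0 := by exact_mod_cast hN.ne'
    field_simp
  have h3 : (fun N : ℕ => (ascPochhammer ℂ N).eval c) =Θ[atTop]
      fun N : ℕ => (N : ℂ) ^ c * N ! / N := by
    refine (EventuallyEq.trans_isTheta ?_ (h1.symm.div h2))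
    filter_upwards with N
    have : c + (N : ℂ) ≠ 0 := fun h => hc N (by linear_combination h)
    rw [ascPochhammer_succ_eval, mul_div_cancel_right₀ _ this]
  refine h3.trans (IsTheta.of_norm_eventuallyEq ?_)
  filter_upwards [eventually_gt_atTop 0] with N hN
  have hN' : (0 : ℝ) < N := by exact_mod_cast hN
  rw [norm_div, norm_mul, Complex.norm_natCast_cpow_of_pos hN, Complex.norm_natCast,
    Complex.norm_natCast, Real.rpow_sub_one hN'.ne']
  ring

theorem ascPochhammer_eventually_eq_zero (j : ℕ) :
    ∀ᶠ N : ℕ in atTop, (ascPochhammer ℂ N).eval (-j : ℂ) = 0 := by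
  filter_upwards [eventually_gt_atTop j] with N hN
  rw [ascPochhammer_eval_eq_prod]
  exact Finset.prod_eq_zero (Finset.mem_range.2 hN) (by simp)

/-- Sequences of integers at bounded distance from the identity. -/
def NearId (e : ℕ → ℕ) : Prop := ∃ K, ∀ M, M ≤ e M + K ∧ e M ≤ M + K

theorem nearId_add (c : ℕ) : NearId fun M => M + c := ⟨c, fun M => by dsimp only; omega⟩

theorem NearId.sub_add {e : ℕ → ℕ} (he : NearId e) (c c' : ℕ) : NearId fun M => e M - c + c' := by
  obtain ⟨K, hK⟩ := he
  exact ⟨K + c + c', fun M => by have := hK M; dsimp only; omega⟩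

theorem NearId.tendsto {e : ℕ → ℕ} (he : NearId e) : Tendsto e atTop atTop := by
  obtain ⟨K, hK⟩ := he
  refine tendsto_atTop.2 fun b => ?_
  filter_upwards [eventually_ge_atTop (b + K)] with M hM
  have := hK M
  omega

theorem NearId.isTheta_rpow {e : ℕ → ℕ} (he : NearId e) (r : ℝ) :
    (fun M => (e M : ℝ) ^ r) =Θ[atTop] fun M : ℕ => (M : ℝ) ^ r := by
  have h1 : Tendsto (fun M => (e M : ℝ) / M) atTop (𝓝 1) := by
    obtain ⟨K, hK⟩ := he
    have hz : Tendsto (fun M : ℕ => (K : ℝ) * (M : ℝ)⁻¹) atTop (𝓝 0) := by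
      simpa using (tendsto_inv_atTop_nhds_zero_nat (𝕜 := ℝ)).const_mul (K : ℝ)
    have hlo : Tendsto (fun M : ℕ => 1 - (K : ℝ) * (M : ℝ)⁻¹) atTop (𝓝 1) := by
      simpa using hz.const_sub 1
    have hhi : Tendsto (fun M : ℕ => 1 + (K : ℝ) * (M : ℝ)⁻¹) atTop (𝓝 1) := by
      simpa using hz.const_add 1
    refine tendsto_of_tendsto_of_tendsto_of_le_of_le' hlo hhi ?_ ?_
    all_goals
      filter_upwards [eventually_gt_atTop 0] with M hM
      have hM' : (0 : ℝ) < M := by exact_mod_cast hM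
      have e1 : (M : ℝ) ≤ e M + K := by exact_mod_cast (hK M).1
      have e2 : (e M : ℝ) ≤ M + K := by exact_mod_cast (hK M).2
      field_simp
      linarith
  have h2 := h1.rpow_const (p := r) (Or.inl one_ne_zero)
  rw [Real.one_rpow] at h2
  refine (isTheta_of_div_tendsto_nhds_ne_zero (c := 1) (h2.congr fun M => ?_) one_ne_zero).symm
  rw [Real.div_rpow (Nat.cast_nonneg _) (Nat.cast_nonneg _)]

/-- The matrix elements of `P_{ko} R⁺_{ko}`. -/
def plusKernel (l u : ℂ) (m t : ℕ) : ℂ :=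
  (m.choose t : ℂ) * finDiff (gammaRatio (2 * l) (1 + l - u)) (m - t) t

theorem plusKernel_eq (l u : ℂ) (hb : ∀ j : ℕ, 1 + l - u ≠ -(j : ℂ)) {m t : ℕ} (h : t ≤ m) :
    plusKernel l u m t = (ascPochhammer ℂ t).eval (2 * l) *
      ((m.choose t : ℂ) * (ascPochhammer ℂ (m - t)).eval (1 - l - u) /
        (ascPochhammer ℂ m).eval (1 + l - u)) := by
  rw [plusKernel, finDiff_gammaRatio _ _ hb, Nat.sub_add_cancel h,
    show 1 + l - u - 2 * l = 1 - l - u by ring]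
  ring

/-- The factorials combine with the binomial coefficient to the constant `1 / t!`. The remaining
powers have exponents whose difference is `(1 - l - u) - (1 + l - u) = -2 * l`, independently of `t`
and `u`. -/
theorem plusKernel_isTheta_aux (l u : ℂ) (hb : ∀ j : ℕ, 1 + l - u ≠ -(j : ℂ))
    (hc : ∀ j : ℕ, 1 - l - u ≠ -(j : ℂ)) {e : ℕ → ℕ} (he : NearId e) (t : ℕ) :
    (fun M => ((e M).choose t : ℂ) * (ascPochhammer ℂ (e M - t)).eval (1 - l - u) /
        (ascPochhammer ℂ (e M)).eval (1 + l - u)) =Θ[atTop]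
      fun M : ℕ => (M : ℝ) ^ (-(2 * l).re) := by
  have he' : NearId fun M => e M - t := he.sub_add t 0
  have h1 : (fun M => (ascPochhammer ℂ (e M - t)).eval (1 - l - u)) =Θ[atTop]
      fun M => ((e M - t)! : ℝ) * ((e M - t : ℕ) : ℝ) ^ ((1 - l - u).re - 1) :=
    ⟨(ascPochhammer_isTheta hc).1.comp_tendsto he'.tendsto,
      (ascPochhammer_isTheta hc).2.comp_tendsto he'.tendsto⟩
  have h2 : (fun M => (ascPochhammer ℂ (e M)).eval (1 + l - u)) =Θ[atTop]
      fun M => ((e M)! : ℝ) * (e M : ℝ) ^ ((1 + l - u).re - 1) :=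
    ⟨(ascPochhammer_isTheta hb).1.comp_tendsto he.tendsto,
      (ascPochhammer_isTheta hb).2.comp_tendsto he.tendsto⟩
  have h3 : (fun M => ((e M).choose t : ℂ)) =Θ[atTop] fun M => ((e M).choose t : ℝ) :=
    IsTheta.of_norm_eventuallyEq (Eventually.of_forall fun M => by simp)
  have h4 := (h3.mul h1).div h2
  have h5 : (fun M => ((e M).choose t : ℝ) *
        (((e M - t)! : ℝ) * ((e M - t : ℕ) : ℝ) ^ ((1 - l - u).re - 1)) /
        (((e M)! : ℝ) * (e M : ℝ) ^ ((1 + l - u).re - 1))) =ᶠ[atTop]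
      fun M => (t ! : ℝ)⁻¹ * (((e M - t : ℕ) : ℝ) ^ ((1 - l - u).re - 1) /
        (e M : ℝ) ^ ((1 + l - u).re - 1)) := by
    filter_upwards [he.tendsto.eventually_ge_atTop t] with M hM
    have hfac : ((e M).choose t : ℝ) * (t ! : ℝ) * ((e M - t)! : ℝ) = ((e M)! : ℝ) := by
      exact_mod_cast Nat.choose_mul_factorial_mul_factorial hM
    have ht : (t ! : ℝ) ≠ 0 := by exact_mod_cast t.factorial_ne_zero
    have hM0 : ((e M)! : ℝ) ≠ 0 := by exact_mod_cast (e M).factorial_ne_zero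
    rw [← mul_assoc, mul_div_mul_comm]
    congr 1
    rw [div_eq_iff hM0, ← hfac]
    field_simp
  have ht : (t ! : ℝ)⁻¹ ≠ 0 := inv_ne_zero (by exact_mod_cast t.factorial_ne_zero)
  have h6 := ((he'.isTheta_rpow ((1 - l - u).re - 1)).div
    (he.isTheta_rpow ((1 + l - u).re - 1))).const_mul_left ht
  refine (h4.trans (h5.trans_isTheta h6)).trans_eventuallyEq ?_
  filter_upwards [eventually_gt_atTop 0] with M hM
  have hM' : (0 : ℝ) < M := by exact_mod_cast hM
  rw [← Real.rpow_sub hM']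
  congr 1
  simp
  ring

theorem plusKernel_isBigO_zero (l u : ℂ) (hb : ∀ j : ℕ, 1 + l - u ≠ -(j : ℂ))
    {j : ℕ} (hc : 1 - l - u = -(j : ℂ)) {e : ℕ → ℕ} (he : NearId e) (t : ℕ) :
    (fun M => plusKernel l u (e M) t) =O[atTop] fun _ : ℕ => (0 : ℝ) := by
  have he' : NearId fun M => e M - t := he.sub_add t 0
  refine EventuallyEq.trans_isBigO (f₂ := fun _ => (0 : ℂ)) ?_ (isBigO_zero _ _)
  filter_upwards [he.tendsto.eventually_ge_atTop t,
    he'.tendsto.eventually (ascPochhammer_eventually_eq_zero j)] with M hM hz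
  rw [plusKernel_eq l u hb hM, hc, hz]
  simp

theorem plusKernel_isBigO (l u : ℂ) (hb : ∀ j : ℕ, 1 + l - u ≠ -(j : ℂ))
    {e : ℕ → ℕ} (he : NearId e) (t : ℕ) :
    (fun M => plusKernel l u (e M) t) =O[atTop] fun M : ℕ => (M : ℝ) ^ (-(2 * l).re) := by
  by_cases hc : ∀ j : ℕ, 1 - l - u ≠ -(j : ℂ)
  · refine IsBigO.trans ?_ (plusKernel_isTheta_aux l u hb hc he t).isBigO
    refine EventuallyEq.trans_isBigO ?_
      (isBigO_const_mul_self ((ascPochhammer ℂ t).eval (2 * l)) _ _)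
    filter_upwards [he.tendsto.eventually_ge_atTop t] with M hM
    rw [plusKernel_eq l u hb hM]
  · push Not at hc
    obtain ⟨j, hj⟩ := hc
    exact (plusKernel_isBigO_zero l u hb hj he t).trans (isBigO_zero _ _)

/-- Only `t = 0` is claimed from below: there the prefactor `(2 * l)_t` equals `1`. -/
theorem plusKernel_zero_isTheta (l u : ℂ) (hb : ∀ j : ℕ, 1 + l - u ≠ -(j : ℂ))
    (hc : ∀ j : ℕ, 1 - l - u ≠ -(j : ℂ)) :
    (fun M => plusKernel l u M 0) =Θ[atTop] fun M : ℕ => (M : ℝ) ^ (-(2 * l).re) := by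
  refine EventuallyEq.trans_isTheta ?_ (plusKernel_isTheta_aux l u hb hc (nearId_add 0) 0)
  filter_upwards with M
  rw [plusKernel_eq l u hb (Nat.zero_le _)]
  simp

end PochhammerAsymptotics

/-! ### Matrix elements of products of the operators `P R⁺`. -/

section MatrixElements

variable {σ : Type}

theorem Moves.mono {S S' : Set σ} {A : Module.End ℂ (MvPolynomial σ ℂ)} (h : Moves S A)
    (hS : S ⊆ S') : Moves S' A := fun d c q hq =>
  ⟨(h d c q hq).1, fun x hx => (h d c q hq).2 x fun hxS => hx (hS hxS)⟩

theorem Moves.ofFn_prod {m : ℕ} {S : Set σ} {A : Fin m → Module.End ℂ (MvPolynomial σ ℂ)}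
    (h : ∀ k, Moves S (A k)) : Moves S (List.ofFn A).prod := by
  classical
  induction m with
  | zero => exact Moves.one.mono (Set.empty_subset _)
  | succ m ih =>
    rw [List.ofFn_succ, List.prod_cons]
    exact ((h 0).mul (ih fun k => h k.succ)).mono (Set.union_subset le_rfl le_rfl)

variable [DecidableEq σ] {o : σ}

theorem moves_sitePlus_prod {m : ℕ} (s : Fin m → σ) (hso : ∀ k, s k ≠ o) (l w : Fin m → ℂ) :
    Moves (insert o (Set.range s)) (List.ofFn fun k => sitePlus (l k) (w k) (s k) o).prod :=
  Moves.ofFn_prod fun k => (moves_sitePlus _ _ (hso k)).mono (by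
    rintro x (rfl | rfl)
    · exact Or.inr ⟨k, rfl⟩
    · exact Or.inl rfl)

theorem moves_siteMinus_prod {m : ℕ} (s : Fin m → σ) (hso : ∀ k, s k ≠ o) (l w : Fin m → ℂ) :
    Moves (insert o (Set.range s)) (List.ofFn fun k => siteMinus (l k) (w k) (s k) o).prod :=
  Moves.ofFn_prod fun k => (moves_siteMinus _ _ (hso k)).mono (by
    rintro x (rfl | rfl)
    · exact Or.inr ⟨k, rfl⟩
    · exact Or.inl rfl)

theorem sitePlus_coeff_eq_plusKernel (l u : ℂ) {k : σ} (hko : k ≠ o) {F : MvPolynomial σ ℂ}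
    {p : ℕ} (hF : ∀ d, F.coeff d ≠ 0 → d k = p) {q : σ →₀ ℕ} (ho : q o = 0) (m : ℕ) :
    (sitePlus l u k o F).coeff (q + single o m) =
      if p ≤ m then plusKernel l u (m - p + q k) (q k) *
          F.coeff (q.erase k + single k p + single o (m - p + q k)) else 0 := by
  have hq : q = q.erase k + single k (q k) := (Finsupp.erase_add_single k q).symm
  have h := sitePlus_coeff l u hko hF (e := q.erase k) (by simp)
    (by simpa [Finsupp.erase_ne hko.symm] using ho) (q k) m
  rw [← hq] at h
  rw [h, plusKernel, Nat.add_sub_cancel]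

/-- The factors to the right of the first do not touch `z_{s 0}`, so its incoming exponent is `p (s
0)` and each matrix element is a kernel value times one matrix element of the shorter product. Each
site shifts the power of `z_o` by a bounded amount, hence `NearId`. The bounds `v k` are left free
so that one of them may later be zero. -/
theorem sitePlus_prod_coeff_isBigO {m : ℕ} (s : Fin m → σ) (hs : Function.Injective s)
    (hso : ∀ k, s k ≠ o) (l w : Fin m → ℂ) (v : Fin m → ℕ → ℝ)
    (hv : ∀ k e, NearId e → ∀ t, (fun M => plusKernel (l k) (w k) (e M) t) =O[atTop] v k)
    (p q : σ →₀ ℕ) (hq : q o = 0) {e : ℕ → ℕ} (he : NearId e) (f : ℕ → ℕ) :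
    (fun M => ((List.ofFn fun k => sitePlus (l k) (w k) (s k) o).prod
      (monomial (p + single o (f M)) 1)).coeff (q + single o (e M))) =O[atTop]
        fun M => ∏ k, v k M := by
  induction m generalizing q e with
  | zero =>
    refine IsBigO.of_bound 1 (Eventually.of_forall fun M => ?_)
    simp only [List.ofFn_zero, List.prod_nil, Module.End.one_apply, coeff_monomial]
    split_ifs <;> simp
  | succ m ih =>
    have hne : ∀ k : Fin m, s k.succ ≠ s 0 := fun k h => Fin.succ_ne_zero k (hs h)
    have hmov := moves_sitePlus_prod (fun k : Fin m => s k.succ) (fun k => hso _)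
      (fun k => l k.succ) (fun k => w k.succ)
    have hF : ∀ M d, ((List.ofFn fun k : Fin m => sitePlus (l k.succ) (w k.succ) (s k.succ) o).prod
        (monomial (p + single o (f M)) 1)).coeff d ≠ 0 → d (s 0) = p (s 0) := by
      intro M d hd
      rw [(hmov _ _ _ hd).2 (s 0)]
      · simp [hso 0]
      · rintro (h | ⟨k, hk⟩)
        · exact hso 0 h
        · exact hne k hk
    have ih' := ih (fun k => s k.succ) (fun a b h => Fin.succ_injective _ (hs h))
      (fun k => hso _) (fun k => l k.succ) (fun k => w k.succ) (fun k => v k.succ)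
      (fun k => hv k.succ) (q.erase (s 0) + single (s 0) (p (s 0)))
      (by simp [Finsupp.erase_ne (hso 0).symm, hq, hso 0]) (he.sub_add (p (s 0)) (q (s 0)))
    have hk := hv 0 _ (he.sub_add (p (s 0)) (q (s 0))) (q (s 0))
    simp only [List.ofFn_succ, List.prod_cons, Module.End.mul_apply, Fin.prod_univ_succ]
    refine IsBigO.trans (IsBigO.of_bound 1 (Eventually.of_forall fun M => ?_)) (hk.mul ih')
    rw [sitePlus_coeff_eq_plusKernel _ _ (hso 0) (hF M) hq]
    split_ifs
    · simp
    · rw [norm_zero]; positivity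

/-- On constants the diagonal elements factor exactly, which gives a lower bound where the general
estimate gives only an upper one. -/
theorem sitePlus_prod_coeff_diag {m : ℕ} (s : Fin m → σ) (hs : Function.Injective s)
    (hso : ∀ k, s k ≠ o) (l w : Fin m → ℂ) (M : ℕ) :
    ((List.ofFn fun k => sitePlus (l k) (w k) (s k) o).prod
      (monomial (single o M) 1)).coeff (single o M) = ∏ k, plusKernel (l k) (w k) M 0 := by
  induction m with
  | zero => simp
  | succ m ih =>
    have hne : ∀ k : Fin m, s k.succ ≠ s 0 := fun k h => Fin.succ_ne_zero k (hs h)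
    have hmov := moves_sitePlus_prod (fun k : Fin m => s k.succ) (fun k => hso _)
      (fun k => l k.succ) (fun k => w k.succ)
    have hF : ∀ d, ((List.ofFn fun k : Fin m => sitePlus (l k.succ) (w k.succ) (s k.succ) o).prod
        (monomial (single o M) 1)).coeff d ≠ 0 → d (s 0) = 0 := by
      intro d hd
      rw [(hmov _ _ _ hd).2 (s 0)]
      · simp [hso 0]
      · rintro (h | ⟨k, hk⟩)
        · exact hso 0 h
        · exact hne k hk
    have ih' := ih (fun k => s k.succ) (fun a b h => Fin.succ_injective _ (hs h))
      (fun k => hso _) (fun k => l k.succ) (fun k => w k.succ)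
    have h := sitePlus_coeff_eq_plusKernel (l 0) (w 0) (hso 0) hF (q := 0) rfl M
    simp only [zero_add, Finsupp.coe_zero, Pi.zero_apply, Nat.zero_le, if_true, Nat.sub_zero,
      add_zero, Finsupp.erase_zero, Finsupp.single_zero] at h
    simp only [List.ofFn_succ, List.prod_cons, Module.End.mul_apply, Fin.prod_univ_succ]
    rw [h, ih']

end MatrixElements

end SpinChain

namespace SpinChain

open MvPolynomial Filter Topology Asymptotics
open Finsupp (single)

/-! ### Criteria for existence of the trace and for decay, in terms of monomials. -/

section Convergence

variable {n : ℕ}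

theorem mapDomain_succ_eq_cons (p : Fin n →₀ ℕ) : p.mapDomain Fin.succ = p.cons 0 := by
  ext i
  refine Fin.cases ?_ (fun i => ?_) i
  · rw [Finsupp.mapDomain_of_notMem_range _ _ (by rintro ⟨k, hk⟩; exact Fin.succ_ne_zero k hk)]
    simp
  · rw [Finsupp.mapDomain_apply (Fin.succ_injective n)]
    simp

theorem cons_eq_add_single (p : Fin n →₀ ℕ) (m : ℕ) : p.cons m = p.cons 0 + single 0 m := by
  ext i
  refine Fin.cases ?_ (fun i => ?_) i
  · simp
  · simp

theorem degree_cons (p : Fin n →₀ ℕ) (m : ℕ) : (p.cons m).degree = m + p.degree := by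
  simp [Finsupp.degree_eq_sum, Fin.sum_univ_succ]

theorem auxIn_monomial (m : ℕ) (p : Fin n →₀ ℕ) (c : ℂ) :
    auxIn m (monomial p c) = monomial (p.cons m) c := by
  show X 0 ^ m * rename Fin.succ (monomial p c) = _
  rw [rename_monomial, mapDomain_succ_eq_cons, X_pow_eq_monomial, monomial_mul, one_mul,
    cons_eq_add_single p m, add_comm (single 0 m)]

theorem coeff_matEl_monomial (A : Module.End ℂ (MvPolynomial (Fin (n + 1)) ℂ)) (i j : ℕ)
    (p q : Fin n →₀ ℕ) (c : ℂ) : (matEl A i j (monomial p c)).coeff q =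
      c * (A (monomial (p.cons j) 1)).coeff (q.cons i) := by
  have : monomial (p.cons j) c = c • monomial (p.cons j) (1 : ℂ) := by
    rw [smul_monomial, smul_eq_mul, mul_one]
  rw [matEl, LinearMap.comp_apply, LinearMap.comp_apply, coeff_auxOut, auxIn_monomial, this,
    map_smul, coeff_smul, smul_eq_mul]

/-- Conservation of the total degree leaves, for each monomial argument, finitely many monomials in
the traced image; so coefficientwise sums assemble to a polynomial. -/
theorem auxTraceConverges_of_summable {A : Module.End ℂ (MvPolynomial (Fin (n + 1)) ℂ)}
    {S : Set (Fin (n + 1))} (hA : Moves S A)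
    (h : ∀ p q : Fin n →₀ ℕ, Summable fun m => (A (monomial (p.cons m) 1)).coeff (q.cons m)) :
    AuxTraceConverges A := by
  classical
  refine ⟨(basisMonomials (Fin n) ℂ).constr ℂ fun p =>
    ∑ q ∈ (Finsupp.finite_of_degree_eq (σ := Fin n) p.degree).toFinset,
      monomial q (∑' m, (A (monomial (p.cons m) 1)).coeff (q.cons m)), fun Ψ q => ?_⟩
  induction Ψ using MvPolynomial.induction_on' with
  | monomial p c =>
    have hc : monomial p c = c • (basisMonomials (Fin n) ℂ) p := by simp [smul_monomial]
    rw [hc, map_smul, Module.Basis.constr_basis, ← hc, coeff_smul, coeff_sum, smul_eq_mul]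
    simp only [auxTerm_eq, coeff_matEl_monomial, coeff_monomial, Finset.sum_ite_eq',
      Set.Finite.mem_toFinset, Set.mem_ofPred_eq]
    refine HasSum.mul_left c ?_
    split_ifs with hd
    · exact (h p q).hasSum
    -- If the degrees of `p` and `q` differ, every term of the series vanishes.
    · convert! hasSum_zero with m
      by_contra hne
      have := (hA _ _ _ hne).1
      rw [degree_cons, degree_cons] at this
      omega
  | add Φ Γ hΦ hΓ =>
    simp only [auxTerm_eq, map_add, coeff_add] at hΦ hΓ ⊢
    exact hΦ.add hΓ

theorem diagDecay_of_tendsto {A : Module.End ℂ (MvPolynomial (Fin (n + 1)) ℂ)}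
    (h : ∀ (p q : Fin n →₀ ℕ) (i j : ℕ), Tendsto (fun N : ℕ => ((N : ℂ) + 1) *
      (A (monomial (p.cons (N + j)) 1)).coeff (q.cons (N + i))) atTop (𝓝 0)) : DiagDecay A := by
  intro i j Ψ
  induction Ψ using MvPolynomial.induction_on' with
  | monomial p c =>
    intro q
    have := (h p q i j).const_mul c
    rw [mul_zero] at this
    refine this.congr fun N => ?_
    rw [coeff_smul, coeff_matEl_monomial, smul_eq_mul]
    ring
  | add Φ Γ hΦ hΓ =>
    have := hΦ.add hΓ
    simpa only [map_add, smul_add, add_zero] using this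

end Convergence

/-! ### The trace for `Q₋` is a finite sum. -/

section Minus

variable {n : ℕ} [NeZero n] (l δ : Fin n → ℂ) (lam : ℂ)

omit [NeZero n] in
theorem moves_monodromyMinus :
    Moves (insert 0 (Set.range (Fin.succ : Fin n → Fin (n + 1)))) (monodromyMinus l δ lam) :=
  moves_siteMinus_prod Fin.succ Fin.succ_ne_zero l fun k => lam + δ k

/-- The leftmost factor acts last and bounds the outgoing power of `z_0` by the power of the first
site variable, which the other factors have left at its initial value. -/
theorem monodromyMinus_coeff_eq_zero (p q : Fin n →₀ ℕ) {i : ℕ} (j : ℕ) (hi : p 0 < i) :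
    (monodromyMinus l δ lam (monomial (p.cons j) 1)).coeff (q.cons i) = 0 := by
  obtain ⟨m, rfl⟩ : ∃ m, n = m + 1 := ⟨n - 1, by have := NeZero.pos n; omega⟩
  rw [monodromyMinus, List.ofFn_succ, List.prod_cons, Module.End.mul_apply]
  have hmov := moves_siteMinus_prod (o := 0) (fun k : Fin m => k.succ.succ)
    (fun k => Fin.succ_ne_zero _) (fun k => l k.succ) (fun k => lam + δ k.succ)
  refine siteMinus_coeff_eq_zero (l 0) (lam + δ 0) (Fin.succ_ne_zero 0) (p := p 0) ?_ (by simpa)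
  intro d hd
  rw [(hmov _ _ _ hd).2 (Fin.succ 0)]
  · exact Finsupp.cons_succ 0 j p
  · rintro (h | ⟨k, hk⟩)
    · exact Fin.succ_ne_zero _ h
    · exact Fin.succ_ne_zero _ (Fin.succ_injective _ hk)

theorem auxTraceConverges_monodromyMinus : AuxTraceConverges (monodromyMinus l δ lam) := by
  refine auxTraceConverges_of_summable (moves_monodromyMinus l δ lam) fun p q => ?_
  refine summable_of_ne_finset_zero (s := Finset.range (p 0 + 1)) fun m hm => ?_
  rw [Finset.mem_range] at hm
  exact monodromyMinus_coeff_eq_zero l δ lam p q m (by omega)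

theorem diagDecay_monodromyMinus : DiagDecay (monodromyMinus l δ lam) := by
  refine diagDecay_of_tendsto fun p q i j => ?_
  refine tendsto_const_nhds.congr' ?_
  filter_upwards [eventually_gt_atTop (p 0)] with N hN
  rw [monodromyMinus_coeff_eq_zero l δ lam p q _ (by omega), mul_zero]

end Minus

/-! ### Convergence of the trace for `Q₊`, and the decay that it forces. -/

section Plus

variable {n : ℕ} (l δ : Fin n → ℂ) (lam : ℂ)

theorem moves_monodromyPlus :
    Moves (insert 0 (Set.range (Fin.succ : Fin n → Fin (n + 1)))) (monodromyPlus l δ lam) :=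
  moves_sitePlus_prod Fin.succ Fin.succ_ne_zero l fun k => lam + δ k

theorem monodromyPlus_coeff_isBigO (v : Fin n → ℕ → ℝ)
    (hv : ∀ k e, NearId e → ∀ t, (fun M => plusKernel (l k) (lam + δ k) (e M) t) =O[atTop] v k)
    (p q : Fin n →₀ ℕ) (i j : ℕ) :
    (fun M => (monodromyPlus l δ lam (monomial (p.cons (M + j)) 1)).coeff (q.cons (M + i)))
      =O[atTop] fun M => ∏ k, v k M := by
  have := sitePlus_prod_coeff_isBigO (o := 0) Fin.succ (Fin.succ_injective n) Fin.succ_ne_zero l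
    (fun k => lam + δ k) v hv (p.cons 0) (q.cons 0) (by simp) (nearId_add i) fun M => M + j
  simp only [← cons_eq_add_single] at this
  exact this

theorem prod_rpow_eventuallyEq : (fun M : ℕ => ∏ k, (M : ℝ) ^ (-(2 * l k).re)) =ᶠ[atTop]
    fun M : ℕ => (M : ℝ) ^ (-(∑ k, 2 * l k).re) := by
  filter_upwards [eventually_gt_atTop 0] with M hM
  have hM' : (0 : ℝ) < M := by exact_mod_cast hM
  rw [← Real.rpow_sum_of_pos hM', Complex.re_sum, Finset.sum_neg_distrib]

theorem monodromyPlus_coeff_isBigO_rpow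
    (hl : ∀ (k : Fin n) (j : ℕ), 1 + l k - (lam + δ k) ≠ -(j : ℂ)) (p q : Fin n →₀ ℕ) (i j : ℕ) :
    (fun M => (monodromyPlus l δ lam (monomial (p.cons (M + j)) 1)).coeff (q.cons (M + i)))
      =O[atTop] fun M : ℕ => (M : ℝ) ^ (-(∑ k, 2 * l k).re) :=
  (monodromyPlus_coeff_isBigO l δ lam _ (fun k _ he t => plusKernel_isBigO _ _ (hl k) he t)
    p q i j).trans_eventuallyEq (prod_rpow_eventuallyEq l)

theorem auxTraceConverges_monodromyPlus
    (hl : ∀ (k : Fin n) (j : ℕ), 1 + l k - (lam + δ k) ≠ -(j : ℂ))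
    (h : 1 < (∑ k, 2 * l k).re) : AuxTraceConverges (monodromyPlus l δ lam) :=
  auxTraceConverges_of_summable (moves_monodromyPlus l δ lam) fun p q =>
    summable_of_isBigO_nat (Real.summable_nat_rpow.2 (by linarith))
      (monodromyPlus_coeff_isBigO_rpow l δ lam hl p q 0 0)

/-- The trace converges on constants only if its terms decay fast enough, or if they vanish
from some point on. -/
theorem re_gt_one_of_converges (hl : ∀ (k : Fin n) (j : ℕ), 1 + l k - (lam + δ k) ≠ -(j : ℂ))
    (hc : ∀ (k : Fin n) (j : ℕ), 1 - l k - (lam + δ k) ≠ -(j : ℂ))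
    (h : AuxTraceConverges (monodromyPlus l δ lam)) : 1 < (∑ k, 2 * l k).re := by
  obtain ⟨B, hB⟩ := h
  have h1 := (hB (monomial 0 1) 0).summable
  simp only [auxTerm_eq, coeff_matEl_monomial, one_mul] at h1
  have h2 : ∀ M : ℕ, (monodromyPlus l δ lam (monomial ((0 : Fin n →₀ ℕ).cons M) 1)).coeff
      ((0 : Fin n →₀ ℕ).cons M) = ∏ k, plusKernel (l k) (lam + δ k) M 0 := by
    intro M
    have hM : (0 : Fin n →₀ ℕ).cons M = single 0 M := by
      rw [cons_eq_add_single, Finsupp.cons_zero_zero, zero_add]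
    rw [hM]
    exact sitePlus_prod_coeff_diag Fin.succ (Fin.succ_injective n) Fin.succ_ne_zero l
      (fun k => lam + δ k) M
  simp only [h2] at h1
  have h3 : (fun M => ∏ k, plusKernel (l k) (lam + δ k) M 0) =Θ[atTop]
      fun M : ℕ => (M : ℝ) ^ (-(∑ k, 2 * l k).re) :=
    (IsTheta.finsetProd fun k _ => plusKernel_zero_isTheta _ _ (hl k) (hc k)).trans_eventuallyEq
      (prod_rpow_eventuallyEq l)
  have := Real.summable_nat_rpow.1 (h3.summable_iff_nat.1 h1)
  linarith

/-- If no `1 - l k - (lam + δ k)` is a nonpositive integer, existence of the trace gives `1 < (∑ k,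
2 * l k).re`, and the power bound beats the weight `N + 1`. Otherwise one local kernel vanishes from
some point on, and with it every matrix element near the diagonal. -/
theorem diagDecay_monodromyPlus (hl : ∀ (k : Fin n) (j : ℕ), 1 + l k - (lam + δ k) ≠ -(j : ℂ))
    (h : AuxTraceConverges (monodromyPlus l δ lam)) : DiagDecay (monodromyPlus l δ lam) := by
  refine diagDecay_of_tendsto fun p q i j => ?_
  by_cases hc : ∀ (k : Fin n) (j : ℕ), 1 - l k - (lam + δ k) ≠ -(j : ℂ)
  · have hre := re_gt_one_of_converges l δ lam hl hc h
    have h1 : (fun N : ℕ => (N : ℂ) + 1) =O[atTop] fun N : ℕ => (N : ℝ) := by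
      refine IsBigO.of_bound 2 ?_
      filter_upwards [eventually_ge_atTop 1] with N hN
      have hN' : (1 : ℝ) ≤ N := by exact_mod_cast hN
      refine (norm_add_le _ _).trans ?_
      simp
      linarith
    refine (h1.mul (monodromyPlus_coeff_isBigO_rpow l δ lam hl p q i j)).trans_tendsto ?_
    have h2 : Tendsto (fun N : ℕ => (N : ℝ) ^ (-((∑ k, 2 * l k).re - 1))) atTop (𝓝 0) :=
      (tendsto_rpow_neg_atTop (by linarith)).comp tendsto_natCast_atTop_atTop
    refine h2.congr' ?_
    filter_upwards [eventually_gt_atTop 0] with N hN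
    have hN' : (0 : ℝ) < N := by exact_mod_cast hN
    rw [neg_sub, sub_eq_add_neg, Real.rpow_add hN', Real.rpow_one]
  · push Not at hc
    obtain ⟨k₀, j₀, hj₀⟩ := hc
    classical
    -- The bound at the exceptional site `k₀` is replaced by zero, so the product of the bounds is
    -- zero.
    have h1 := monodromyPlus_coeff_isBigO l δ lam
      (Function.update (fun k M => (M : ℝ) ^ (-(2 * l k).re)) k₀ fun _ => 0) (fun k e he t => by
        by_cases hk : k = k₀
        · subst hk
          rw [Function.update_self]
          exact plusKernel_isBigO_zero _ _ (hl k) hj₀ he t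
        · rw [Function.update_of_ne hk]
          exact plusKernel_isBigO _ _ (hl k) he t) p q i j
    have h2 : ∀ M : ℕ, ∏ k, Function.update (fun k (M : ℕ) => (M : ℝ) ^ (-(2 * l k).re)) k₀
        (fun _ => 0) k M = 0 := fun M =>
      Finset.prod_eq_zero (Finset.mem_univ k₀) (by rw [Function.update_self])
    simp only [h2] at h1
    refine tendsto_const_nhds.congr' ?_
    filter_upwards [isBigO_zero_right_iff.1 h1] with N hN
    rw [hN, Pi.zero_apply, mul_zero]

end Plus

end SpinChain

end

theorem proposition8 (n : ℕ) [NeZero n] (l δ : Fin n → ℂ)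
    (hl : ∀ (k : Fin n) (j : ℕ), 2 * l k ≠ -(j : ℂ)) :
    -- `Q₋(lam)` exists for every `lam` and intertwines the transfer matrices
    (∀ lam : ℂ,
      SpinChain.AuxTraceConverges (SpinChain.monodromyMinus l δ lam) ∧
      ∀ u : ℂ,
        SpinChain.qMinus l δ lam *
            SpinChain.transferMatrix (fun k => u + δ k + l k) (fun k => u + δ k - l k) =
          SpinChain.transferMatrix (fun k => u + δ (k + 1) + l (k + 1)) (fun k => u + δ k - l k) *
            SpinChain.qMinus l δ lam) ∧
    -- `Q₊(lam)`, whose local factors are defined when no `1 + l k - lam - δ k` is a pole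
    (∀ lam : ℂ, (∀ (k : Fin n) (j : ℕ), 1 + l k - (lam + δ k) ≠ -(j : ℂ)) →
      (1 < (∑ k, 2 * l k).re →
        SpinChain.AuxTraceConverges (SpinChain.monodromyPlus l δ lam)) ∧
      (SpinChain.AuxTraceConverges (SpinChain.monodromyPlus l δ lam) →
        (∀ u : ℂ,
          SpinChain.transferMatrix (fun k => u + δ k + l k) (fun k => u + δ k - l k) *
              SpinChain.qPlus l δ lam =
            SpinChain.qPlus l δ lam *
              SpinChain.transferMatrix (fun k => u + δ k + l k)
                (fun k => u + δ (k - 1) - l (k - 1))) ∧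
        -- `Q₊(lam) P Q₋(mu)` commutes with `t(u)`
        (∀ mu u : ℂ,
          Commute
            (SpinChain.qPlus l δ lam * SpinChain.cyclicShift n * SpinChain.qMinus l δ mu)
            (SpinChain.transferMatrix (fun k => u + δ k + l k) (fun k => u + δ k - l k))))) := by
  have hminus := fun lam u => SpinChain.intertwine_minus l δ lam hl
    (SpinChain.hasAuxTrace_auxTrace (SpinChain.auxTraceConverges_monodromyMinus l δ lam))
    (SpinChain.diagDecay_monodromyMinus l δ lam) u
  refine ⟨fun lam => ⟨SpinChain.auxTraceConverges_monodromyMinus l δ lam, hminus lam⟩,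
    fun lam hlam => ⟨SpinChain.auxTraceConverges_monodromyPlus l δ lam hlam, fun hconv => ?_⟩⟩
  have hplus := SpinChain.intertwine_plus l δ lam hlam (SpinChain.hasAuxTrace_auxTrace hconv)
    (SpinChain.diagDecay_monodromyPlus l δ lam hlam hconv)
  refine ⟨hplus, fun mu u => ?_⟩
  -- The shift turns the pairing of `u_{k+1}⁺` with `u_k⁻`, produced by `Q₋`, into that of `u_k⁺`
  -- with `u_{k-1}⁻`, which `Q₊` carries back to the original one.
  have hshift := SpinChain.cyclicShift_mul_transferMatrix
    (fun k => u + δ (k + 1) + l (k + 1)) (fun k => u + δ k - l k)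
  simp only [sub_add_cancel] at hshift
  have h1 := hminus mu u
  have h2 := hplus u
  rw [← SpinChain.qMinus] at h1
  rw [← SpinChain.qPlus] at h2
  rw [commute_iff_eq, mul_assoc, mul_assoc, h1, ← mul_assoc (SpinChain.cyclicShift n), hshift,
    ← mul_assoc, ← mul_assoc, ← h2]
  simp only [mul_assoc]
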